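/- Let $\mathbb{G}$ be a Carnot group, that is, a connected, simply connected Lie group with stratified Lie algebra $\mathfrak{g}=V_1\oplus\cdots\oplus V_s$, $[V_1,V_i]=V_{i+1}$ for $1\le i<s$, $[V_1,V_s]=\{0\}$. Identify $\mathbb{G}$ with $\mathbb{R}^N$ through exponential coordinates $x=\exp(x_1X_1+\cdots+x_NX_N)$ with respect to a basis of $\mathfrak{g}$ adapted to the stratification, and let $n=\dim V_1$, so that $x_1,\dots,x_n$ are the horizontal (first-layer) coordinates. For $t>0$ let $\delta_t$ be the dilation that multiplies each coordinate belonging to $V_i$ by $t^i$. Let $d$ be a metric on $\mathbb{G}$ which is left-invariant, $d(px,py)=d(x,y)$, homogeneous, $d(\delta_t(x),\delta_t(y))=t\,d(x,y)$ for $t>0$, and which agrees with the Euclidean metric on horizontal vectors, $d((v,0),0)=|v|$ for $v\in\mathbb{R}^n$. Let $\mathcal{H}^1$ be the Hausdorff $1$-measure of $(\mathbb{G},d)$. Let $a\le b$ and let $\gamma:[a,b]\to(\mathbb{G},d)$ be Lipschitz. Write $\gamma(t)=(\gamma_1(t),\gamma_2(t))\in\mathbb{R}^n\times\mathbb{R}^{N-n}$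 and $G=\gamma([a,b])$, and assume that $\gamma$ is essentially injective: $\mathcal{H}^1$-almost every $p\in G$ has exactly one preimage under $\gamma$. Then $\gamma_1$ is differentiable at almost every $t\in[a,b]$, and for every real-valued $\eta\in L^1(\mathcal{H}^1|_G)$ the function $t\mapsto\eta(\gamma(t))\,|\gamma_1'(t)|$ is integrable on $[a,b]$ and $$\int_G\eta\,d\mathcal{H}^1=\int_a^b\eta(\gamma(t))\,|\gamma_1'(t)|\,dt.$$ -/

import Mathlib

open MeasureTheory Set
open scoped ContDiff NNReal

noncomputable section

/-- The anisotropic dilation `(x_j)_j ↦ (t ^ deg j * x_j)_j` of `ℝ^N`. -/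
def gradedDilation {N : ℕ} (deg : Fin N → ℕ) (t : ℝ) (x : EuclideanSpace ℝ (Fin N)) :
    EuclideanSpace ℝ (Fin N) :=
  WithLp.toLp 2 (fun j => t ^ deg j * x j)

/-- The span of the standard basis vectors of degree `i`. -/
def gradedLayer {N : ℕ} (deg : Fin N → ℕ) (i : ℕ) : Submodule ℝ (EuclideanSpace ℝ (Fin N)) :=
  Submodule.span ℝ {v | ∃ j, deg j = i ∧ v = EuclideanSpace.single j (1 : ℝ)}

/-- The left-invariant vector field, for the group law `m` on `E` with identity element `0`, whose
value at `0` is `v`. Its value at `p` is the derivative at `0` of left translation by `p`, applied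
to `v`. -/
def leftInvariantField {E : Type*} [NormedAddCommGroup E] [NormedSpace ℝ E]
    (m : E → E → E) (v : E) (p : E) : E :=
  fderiv ℝ (m p) 0 v

/-- The Lie bracket of the Lie algebra (the tangent space at the identity element `0`) of the
group law `m`: the value at `0` of the Lie bracket of the left-invariant vector fields. -/
def lieAlgebraBracket {E : Type*} [NormedAddCommGroup E] [NormedSpace ℝ E]
    (m : E → E → E) (v w : E) : E :=
  VectorField.lieBracket ℝ (leftInvariantField m v) (leftInvariantField m w) 0

/-- A Carnot group structure on the group `G`, of topological dimension `N`, presented in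
exponential coordinates `x = exp (x_1 X_1 + ⋯ + x_N X_N)` with respect to a basis `X_1, …, X_N` of
the Lie algebra `𝔤` adapted to the stratification `𝔤 = V_1 ⊕ ⋯ ⊕ V_s`, so that `V_i` is spanned by
the `X_j` with `deg j = i`. The Lie group `G` is connected and simply connected, being identified
with `ℝ^N` as a manifold through `coord`; its Lie algebra is identified with `ℝ^N` as the tangent
space at the identity, with `X_j` the `j`-th standard basis vector.

This is the notion of a homogeneous Carnot group (smooth group law on `ℝ^N`, dilations that are
automorphisms, a Lie algebra stratified with first layer `V_1`), in exponential coordinates. -/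
structure CarnotGroup (G : Type*) [Group G] (N : ℕ) where
  /-- The exponential coordinates. -/
  coord : G ≃ EuclideanSpace ℝ (Fin N)
  /-- The degree of each coordinate, that is, the layer containing `X_j`. -/
  deg : Fin N → ℕ
  deg_pos : ∀ j, 1 ≤ deg j
  deg_mono : Monotone deg
  /-- The group law is smooth. -/
  smooth : ContDiff ℝ ∞
    (fun p : EuclideanSpace ℝ (Fin N) × EuclideanSpace ℝ (Fin N) =>
      coord (coord.symm p.1 * coord.symm p.2))
  /-- The coordinates are exponential: lines through the origin are one-parameter subgroups. -/
  exponential : ∀ (x : EuclideanSpace ℝ (Fin N)) (r t : ℝ),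
    coord.symm ((r + t) • x) = coord.symm (r • x) * coord.symm (t • x)
  /-- The dilations are group automorphisms. -/
  dilation_mul : ∀ t : ℝ, 0 < t → ∀ x y : G,
    gradedDilation deg t (coord (x * y)) =
      coord (coord.symm (gradedDilation deg t (coord x)) *
        coord.symm (gradedDilation deg t (coord y)))
  /-- The Lie algebra is stratified: `[V_1, V_i] = V_{i+1}`, where `V_i` is zero as soon as `i`
  exceeds all the degrees. -/
  stratified : ∀ i : ℕ, 1 ≤ i →
    Submodule.span ℝ {z | ∃ v ∈ gradedLayer deg 1, ∃ w ∈ gradedLayer deg i,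
      z = lieAlgebraBracket (fun x y => coord (coord.symm x * coord.symm y)) v w} =
    gradedLayer deg (i + 1)

namespace CarnotGroup

variable {G : Type*} [Group G] {N : ℕ}

/-- The dilation `δ_t` of `G`. -/
def dilation (𝔾 : CarnotGroup G N) (t : ℝ) (x : G) : G :=
  𝔾.coord.symm (gradedDilation 𝔾.deg t (𝔾.coord x))

/-- The horizontal (first-layer) coordinates `x_1 ∈ ℝ^n`, `n = dim V_1`, of a point of `G`. -/
def horizontal (𝔾 : CarnotGroup G N) (x : G) : EuclideanSpace ℝ {j : Fin N // 𝔾.deg j = 1} :=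
  WithLp.toLp 2 (fun j => 𝔾.coord x j.1)

/-- The metric of `G` is left-invariant and homogeneous. -/
structure IsHomogeneousMetric (𝔾 : CarnotGroup G N) [MetricSpace G] : Prop where
  left_invariant : ∀ p x y : G, dist (p * x) (p * y) = dist x y
  homogeneous : ∀ t : ℝ, 0 < t → ∀ x y : G,
    dist (𝔾.dilation t x) (𝔾.dilation t y) = t * dist x y

/-- The metric of `G` agrees with the Euclidean one on horizontal vectors:
`d(exp v, 1) = |v|` for every `v` in the first layer. -/
def IsNormalizedMetric (𝔾 : CarnotGroup G N) [MetricSpace G] : Prop :=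
  ∀ v ∈ gradedLayer 𝔾.deg 1, dist (𝔾.coord.symm v) 1 = ‖v‖

end CarnotGroup

end

/-! The formula is the area formula for curves in a metric space, applied after identifying the
metric derivative of `γ` with the speed of its horizontal part.

The horizontal projection is a homomorphism onto the first layer, and it is 1-Lipschitz
(`norm_horizontal_le`): rescaling `g ^ k` by `1 / k` keeps the distance to the identity at most
`dist g 1` and converges to the horizontal part of `g`. Hence `γ₁` is Lipschitz, differentiable
almost everywhere by Rademacher, and its speed bounds the metric derivative from below.

For the upper bound (`exists_chain_bound`, `dist_le_of_hasDerivAt`), the curve is blown up by a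
dilation and cut into `k` steps. Non-horizontal coordinates scale at least quadratically, so
replacing each step by `exp (w / k)` costs `O(k⁻²)` plus a small horizontal error, and the total
stays small. The endpoint is thus close to `exp w` in coordinates.

To turn this into a bound on `d`, the distance to the identity must be continuous in the Euclidean
topology, which is not assumed. Stratification makes horizontal elements generate the group
(`closure_horizontal`); Baire then bounds `d` near the identity, and homogeneity and left invariance
give continuity.

Finally (`hausdorffMeasure_restrict_image_eq_map`), domain pieces on which `γ` nearly scales
distances by a constant compare `μH[1]` on the image with the integral of the metric derivative.
Essential injectivity makes the restricted Hausdorff measure the push-forward of `|γ₁'| dt`. -/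

open Filter Topology
open scoped ENNReal

/-! ### Second order expansion of a group law -/

/-- Second order expansion at the identity of a smooth law with identity element `0`. -/
theorem exists_bilinear_expansion {E : Type*} [NormedAddCommGroup E] [NormedSpace ℝ E]
    {m : E → E → E} (hm : ContDiff ℝ ∞ (fun p : E × E => m p.1 p.2))
    (h0 : ∀ x, m x 0 = x) (h0' : ∀ y, m 0 y = y) :
    ∃ B : E →L[ℝ] E →L[ℝ] E, (∀ v w, lieAlgebraBracket m v w = B v w - B w v) ∧
      ∀ ε > 0, ∃ r > 0, ∀ x y : E, ‖x‖ < r → ‖y‖ < r →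
        ‖m x y - x - y - B x y‖ ≤ ε * ‖x‖ * ‖y‖ := by
  set M : E × E → E := fun p => m p.1 p.2 with hM
  set Φ : E × E → E →L[ℝ] E := fun p =>
    (fderiv ℝ M p).comp (ContinuousLinearMap.inr ℝ E E) with hΦ
  have hMd : ∀ p, HasFDerivAt M (fderiv ℝ M p) p := fun p =>
    ((hm.differentiable (by simp)) p).hasFDerivAt
  have hΦs : ContDiff ℝ 1 Φ := by
    have h1 : ContDiff ℝ 1 (fderiv ℝ M) := hm.fderiv_right (by norm_cast)
    exact h1.clm_comp contDiff_const
  have hmd : ∀ x y, HasFDerivAt (m x) (Φ (x, y)) y := fun x y => by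
    have h := (hMd (x, y)).comp y (hasFDerivAt_prodMk_right x y)
    exact h
  have hΦ0 : ∀ y, Φ (0, y) = ContinuousLinearMap.id ℝ E := fun y => by
    have h1 := hmd 0 y
    have h2 : m 0 = id := funext h0'
    rw [h2] at h1
    exact h1.unique (hasFDerivAt_id y)
  set B : E →L[ℝ] E →L[ℝ] E := (fderiv ℝ Φ (0, 0)).comp (ContinuousLinearMap.inl ℝ E E) with hB
  have hΦd : HasStrictFDerivAt Φ (fderiv ℝ Φ (0, 0)) (0, 0) :=
    hΦs.contDiffAt.hasStrictFDerivAt (by simp)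
  refine ⟨B, fun v w => ?_, fun ε hε => ?_⟩
  · have hfield : ∀ v p, leftInvariantField m v p = Φ (p, 0) v := fun v p => by
      rw [leftInvariantField, (hmd p 0).fderiv]
    have hd : ∀ v w, fderiv ℝ (leftInvariantField m v) 0 w = B w v := fun v w => by
      have h1 : leftInvariantField m v = fun p => Φ (p, 0) v := funext (hfield v)
      have h2 : HasFDerivAt (fun p : E => Φ (p, 0)) B 0 :=
        HasFDerivAt.comp (f := fun p : E => (p, (0 : E))) (0 : E) hΦd.hasFDerivAt
          (hasFDerivAt_prodMk_left (0 : E) (0 : E))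
      have h3 := h2.clm_apply (hasFDerivAt_const v (0 : E))
      rw [h1, h3.fderiv]
      simp
    rw [lieAlgebraBracket, VectorField.lieBracket, hd, hd, hfield, hfield, hΦ0]
    simp
  · have h1 := (hΦd.isLittleO).def hε
    rw [nhds_prod_eq] at h1
    obtain ⟨r, hr, h1⟩ := Metric.eventually_nhds_iff.1
      (show ∀ᶠ p in 𝓝 (((0 : E), (0 : E)), ((0 : E), (0 : E))), _ by
        rw [nhds_prod_eq]; exact h1)
    refine ⟨r, hr, fun x y hx hy => ?_⟩
    -- The points `(x, z)` and `(0, z)` differ only in the first factor, so strict differentiability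
    -- gives an error `ε * ‖x‖` uniform in `z`. The mean value inequality in `z` then yields the
    -- product `‖x‖ * ‖y‖`, which allows the two arguments to be rescaled independently.
    have hbound : ∀ z ∈ Metric.ball (0 : E) r,
        ‖Φ (x, z) - ContinuousLinearMap.id ℝ E - B x‖ ≤ ε * ‖x‖ := fun z hz => by
      have := @h1 ((x, z), (0, z)) (by
        simp only [Prod.dist_eq, dist_zero_right]
        rw [mem_ball_zero_iff] at hz
        simp [hx, hz])
      simpa [hΦ0, hB] using this
    have := (convex_ball (0 : E) r).norm_image_sub_le_of_norm_hasFDerivWithin_le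
      (f := fun z => m x z - z - B x z)
      (fun z hz => (((hmd x z).sub (hasFDerivAt_id z)).sub (B x).hasFDerivAt).hasFDerivWithinAt)
      hbound (Metric.mem_ball_self hr) (mem_ball_zero_iff.2 hy)
    simp only [h0, map_zero, sub_zero] at this
    calc _ = ‖m x y - y - B x y - x‖ := by congr 1; abel
      _ ≤ _ := this

/-! ### Dilations and leading graded parts -/

section Graded

variable {N : ℕ} {deg : Fin N → ℕ}

@[simp] theorem gradedDilation_apply (t : ℝ) (x : EuclideanSpace ℝ (Fin N)) (j : Fin N) :
    gradedDilation deg t x j = t ^ deg j * x j := rfl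

/-- The component of degree `i` of a vector. -/
def layerPart (deg : Fin N → ℕ) (i : ℕ) (x : EuclideanSpace ℝ (Fin N)) :
    EuclideanSpace ℝ (Fin N) :=
  WithLp.toLp 2 (fun j => if deg j = i then x j else 0)

@[simp] theorem layerPart_apply (i : ℕ) (x : EuclideanSpace ℝ (Fin N)) (j : Fin N) :
    layerPart deg i x j = if deg j = i then x j else 0 := rfl

theorem mem_gradedLayer {i : ℕ} {x : EuclideanSpace ℝ (Fin N)} :
    x ∈ gradedLayer deg i ↔ ∀ j, deg j ≠ i → x j = 0 := by
  constructor
  · intro h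
    induction h using Submodule.span_induction with
    | mem x h =>
      obtain ⟨j, hj, rfl⟩ := h
      intro k hk
      have : k ≠ j := fun h => hk (h ▸ hj)
      simp [this]
    | zero => simp
    | add x y _ _ hx hy => intro j hj; simp [hx j hj, hy j hj]
    | smul c x _ hx => intro j hj; simp [hx j hj]
  · intro h
    have hx : x = ∑ j, x j • EuclideanSpace.single j (1 : ℝ) := by
      ext k
      simp [Finset.sum_apply, Pi.single_apply]
    rw [hx]
    refine Submodule.sum_mem _ fun j _ => ?_
    by_cases hj : deg j = i
    · exact Submodule.smul_mem _ _ (Submodule.subset_span ⟨j, hj, rfl⟩)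
    · simp [h j hj]

theorem layerPart_mem (i : ℕ) (x : EuclideanSpace ℝ (Fin N)) :
    layerPart deg i x ∈ gradedLayer deg i :=
  mem_gradedLayer.2 fun j hj => by simp [hj]

theorem layerPart_of_mem {i : ℕ} {x : EuclideanSpace ℝ (Fin N)} (hx : x ∈ gradedLayer deg i) :
    layerPart deg i x = x := by
  ext j
  by_cases hj : deg j = i
  · simp [hj]
  · simp [hj, mem_gradedLayer.1 hx j hj]

/-- A vector all of whose components of degree less than `i` vanish. -/
def DegreeGE (deg : Fin N → ℕ) (i : ℕ) (x : EuclideanSpace ℝ (Fin N)) : Prop :=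
  ∀ j, deg j < i → x j = 0

theorem tendsto_euclidean {ι : Type*} {l : Filter ι} {n : Type*} [Fintype n]
    {u : ι → EuclideanSpace ℝ n} {z : EuclideanSpace ℝ n} :
    Tendsto u l (𝓝 z) ↔ ∀ j, Tendsto (fun r => u r j) l (𝓝 (z j)) := by
  rw [(PiLp.homeomorph 2 (fun _ : n => ℝ)).isInducing.tendsto_nhds_iff, tendsto_pi_nhds]
  rfl

theorem continuous_gradedDilation :
    Continuous fun p : ℝ × EuclideanSpace ℝ (Fin N) => gradedDilation deg p.1 p.2 := by
  refine (PiLp.continuous_toLp 2 _).comp (continuous_pi fun j => ?_)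
  fun_prop

/-- Together with its converse `degreeGE_of_tendsto`, this reads the leading graded part off a limit
as `r → 0`. Dilations being automorphisms, graded identities for the group law then follow from its
second order expansion alone, without the Baker–Campbell–Hausdorff formula. -/
theorem tendsto_gradedDilation {i : ℕ} {x : EuclideanSpace ℝ (Fin N)} (hx : DegreeGE deg i x) :
    Tendsto (fun r : ℝ => (r ^ i)⁻¹ • gradedDilation deg r x) (𝓝[>] 0)
      (𝓝 (layerPart deg i x)) := by
  refine tendsto_euclidean.2 fun j => ?_
  rcases lt_or_ge (deg j) i with hj | hj
  · simp [hx j hj]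
  · have h1 : Tendsto (fun r : ℝ => r ^ (deg j - i) * x j) (𝓝[>] 0)
        (𝓝 (0 ^ (deg j - i) * x j)) :=
      (Continuous.tendsto (by fun_prop) 0).mono_left nhdsWithin_le_nhds
    have h2 : (0 : ℝ) ^ (deg j - i) * x j = layerPart deg i x j := by
      rcases hj.eq_or_lt with h | h
      · simp [h]
      · simp [h.ne', (Nat.sub_pos_of_lt h).ne']
    rw [← h2]
    refine h1.congr' ?_
    filter_upwards [self_mem_nhdsWithin] with r hr
    have hr' : (r : ℝ) ≠ 0 := (mem_Ioi.1 hr).ne'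
    simp only [PiLp.smul_apply, gradedDilation_apply, smul_eq_mul]
    rw [pow_sub₀ _ hr' hj]
    ring

theorem degreeGE_of_tendsto {i : ℕ} {x z : EuclideanSpace ℝ (Fin N)}
    (h : Tendsto (fun r : ℝ => (r ^ i)⁻¹ • gradedDilation deg r x) (𝓝[>] 0) (𝓝 z)) :
    DegreeGE deg i x ∧ ∀ j, deg j = i → x j = z j := by
  have h' := tendsto_euclidean.1 h
  constructor
  · intro j hj
    have h1 : Tendsto (fun r : ℝ => r ^ (i - deg j)) (𝓝[>] 0) (𝓝 0) := by
      have : Tendsto (fun r : ℝ => r ^ (i - deg j)) (𝓝[>] 0) (𝓝 (0 ^ (i - deg j))) :=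
        (Continuous.tendsto (by fun_prop) 0).mono_left nhdsWithin_le_nhds
      rwa [zero_pow (Nat.sub_pos_of_lt hj).ne'] at this
    have h2 := h1.mul (h' j)
    rw [zero_mul] at h2
    refine tendsto_nhds_unique (tendsto_const_nhds.congr' ?_) h2
    filter_upwards [self_mem_nhdsWithin] with r hr
    have hr' : (r : ℝ) ≠ 0 := (mem_Ioi.1 hr).ne'
    simp only [PiLp.smul_apply, gradedDilation_apply, smul_eq_mul]
    rw [pow_sub₀ _ hr' hj.le]
    field_simp
  · intro j hj
    refine tendsto_nhds_unique (tendsto_const_nhds.congr' ?_) (h' j)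
    filter_upwards [self_mem_nhdsWithin] with r hr
    have hr' : (r : ℝ) ≠ 0 := (mem_Ioi.1 hr).ne'
    simp only [PiLp.smul_apply, gradedDilation_apply, smul_eq_mul, hj]
    field_simp

theorem tendsto_gradedDilation_zero (hdeg : ∀ j, 1 ≤ deg j) (x : EuclideanSpace ℝ (Fin N)) :
    Tendsto (fun r : ℝ => gradedDilation deg r x) (𝓝[>] 0) (𝓝 0) := by
  have h : Continuous fun r : ℝ => gradedDilation deg r x :=
    continuous_gradedDilation.comp (continuous_id.prodMk continuous_const)
  have h0 : gradedDilation deg 0 x = 0 := by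
    ext j
    have := hdeg j
    simp [show deg j ≠ 0 by omega]
  simpa [h0] using (h.tendsto 0).mono_left (nhdsWithin_le_nhds (s := Ioi 0))

theorem gradedDilation_gradedDilation (s t : ℝ) (x : EuclideanSpace ℝ (Fin N)) :
    gradedDilation deg s (gradedDilation deg t x) = gradedDilation deg (s * t) x := by
  ext j
  simp [mul_pow, mul_assoc]

theorem gradedDilation_one (x : EuclideanSpace ℝ (Fin N)) : gradedDilation deg 1 x = x := by
  ext j
  simp

end Graded

/-! ### The group law in coordinates and generation by the first layer -/

namespace CarnotGroup

variable {G : Type*} [Group G] {N : ℕ} (𝔾 : CarnotGroup G N)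

/-- The group law in exponential coordinates. -/
def law (x y : EuclideanSpace ℝ (Fin N)) : EuclideanSpace ℝ (Fin N) :=
  𝔾.coord (𝔾.coord.symm x * 𝔾.coord.symm y)

theorem coord_mul (g h : G) : 𝔾.coord (g * h) = 𝔾.law (𝔾.coord g) (𝔾.coord h) := by
  simp [law]

theorem symm_law (x y : EuclideanSpace ℝ (Fin N)) :
    𝔾.coord.symm (𝔾.law x y) = 𝔾.coord.symm x * 𝔾.coord.symm y := by
  simp [law]

@[simp] theorem symm_zero : 𝔾.coord.symm 0 = 1 := by
  simpa using 𝔾.exponential 0 0 0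

@[simp] theorem coord_one : 𝔾.coord 1 = 0 := by
  rw [← 𝔾.symm_zero, Equiv.apply_symm_apply]

@[simp] theorem law_zero_right (x : EuclideanSpace ℝ (Fin N)) : 𝔾.law x 0 = x := by simp [law]

@[simp] theorem law_zero_left (x : EuclideanSpace ℝ (Fin N)) : 𝔾.law 0 x = x := by simp [law]

theorem symm_neg (x : EuclideanSpace ℝ (Fin N)) : 𝔾.coord.symm (-x) = (𝔾.coord.symm x)⁻¹ := by
  have := 𝔾.exponential x (-1) 1
  rw [neg_add_cancel, zero_smul, one_smul, neg_one_smul, symm_zero] at this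
  exact eq_inv_of_mul_eq_one_left this.symm

theorem coord_inv (g : G) : 𝔾.coord g⁻¹ = -𝔾.coord g := by
  rw [← Equiv.eq_symm_apply, symm_neg, Equiv.symm_apply_apply]

theorem symm_nsmul (k : ℕ) (x : EuclideanSpace ℝ (Fin N)) :
    𝔾.coord.symm ((k : ℝ) • x) = 𝔾.coord.symm x ^ k := by
  induction k with
  | zero => simp
  | succ k ih =>
    rw [pow_succ, ← ih, Nat.cast_succ, 𝔾.exponential x k 1, one_smul]

theorem gradedDilation_law {t : ℝ} (ht : 0 < t) (x y : EuclideanSpace ℝ (Fin N)) :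
    gradedDilation 𝔾.deg t (𝔾.law x y) =
      𝔾.law (gradedDilation 𝔾.deg t x) (gradedDilation 𝔾.deg t y) := by
  simpa [law] using 𝔾.dilation_mul t ht (𝔾.coord.symm x) (𝔾.coord.symm y)

theorem coord_dilation (t : ℝ) (g : G) :
    𝔾.coord (𝔾.dilation t g) = gradedDilation 𝔾.deg t (𝔾.coord g) := by
  simp [dilation]

theorem symm_gradedDilation (t : ℝ) (x : EuclideanSpace ℝ (Fin N)) :
    𝔾.coord.symm (gradedDilation 𝔾.deg t x) = 𝔾.dilation t (𝔾.coord.symm x) := by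
  simp [dilation]

theorem dilation_mul' {t : ℝ} (ht : 0 < t) (g h : G) :
    𝔾.dilation t (g * h) = 𝔾.dilation t g * 𝔾.dilation t h := by
  apply 𝔾.coord.injective
  rw [coord_dilation, coord_mul, gradedDilation_law _ ht, coord_mul, coord_dilation,
    coord_dilation]

theorem dilation_one {t : ℝ} : 𝔾.dilation t 1 = 1 := by
  apply 𝔾.coord.injective
  rw [coord_dilation, coord_one]
  ext j
  simp

theorem contDiff_law :
    ContDiff ℝ ∞ (fun p : EuclideanSpace ℝ (Fin N) × EuclideanSpace ℝ (Fin N) =>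
      𝔾.law p.1 p.2) := 𝔾.smooth

theorem continuous_law :
    Continuous (fun p : EuclideanSpace ℝ (Fin N) × EuclideanSpace ℝ (Fin N) =>
      𝔾.law p.1 p.2) := 𝔾.contDiff_law.continuous

/-- The bilinear part of the group law determines the Lie bracket. -/
theorem exists_law_expansion :
    ∃ B : EuclideanSpace ℝ (Fin N) →L[ℝ] EuclideanSpace ℝ (Fin N) →L[ℝ] EuclideanSpace ℝ (Fin N),
      (∀ v w, lieAlgebraBracket 𝔾.law v w = B v w - B w v) ∧
      ∀ ε > 0, ∃ r > 0, ∀ x y, ‖x‖ < r → ‖y‖ < r →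
        ‖𝔾.law x y - x - y - B x y‖ ≤ ε * ‖x‖ * ‖y‖ :=
  exists_bilinear_expansion 𝔾.contDiff_law 𝔾.law_zero_right 𝔾.law_zero_left

/-- The group law is the sum up to an error whose scaled limit is the bilinear part. -/
theorem tendsto_law_sub
    {B : EuclideanSpace ℝ (Fin N) →L[ℝ] EuclideanSpace ℝ (Fin N) →L[ℝ] EuclideanSpace ℝ (Fin N)}
    (hB : ∀ ε > 0, ∃ r > 0, ∀ x y, ‖x‖ < r → ‖y‖ < r →
        ‖𝔾.law x y - x - y - B x y‖ ≤ ε * ‖x‖ * ‖y‖)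
    {ι : Type*} {l : Filter ι} {X Y : ι → EuclideanSpace ℝ (Fin N)} {a b : ι → ℝ}
    {x y : EuclideanSpace ℝ (Fin N)}
    (hX0 : Tendsto X l (𝓝 0)) (hY0 : Tendsto Y l (𝓝 0))
    (hX : Tendsto (fun r => a r • X r) l (𝓝 x)) (hY : Tendsto (fun r => b r • Y r) l (𝓝 y)) :
    Tendsto (fun r => (a r * b r) • (𝔾.law (X r) (Y r) - X r - Y r)) l (𝓝 (B x y)) := by
  have h1 : Tendsto (fun r => B (a r • X r) (b r • Y r)) l (𝓝 (B x y)) :=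
    (B.isBoundedBilinearMap.continuous.tendsto (x, y)).comp (hX.prodMk_nhds hY)
  have h2 : Tendsto (fun r => (a r * b r) •
      (𝔾.law (X r) (Y r) - X r - Y r - B (X r) (Y r))) l (𝓝 0) := by
    rw [Metric.tendsto_nhds]
    intro ε hε
    set c := ‖x‖ * ‖y‖ + 1 with hc
    have hc0 : 0 < c := by positivity
    obtain ⟨ρ, hρ, h⟩ := hB (ε / (2 * c)) (by positivity)
    have h3 : ∀ᶠ r in l, ‖a r • X r‖ * ‖b r • Y r‖ < c :=
      (hX.norm.mul hY.norm).eventually (gt_mem_nhds (by simp [hc]))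
    filter_upwards [h3, hX0.eventually (Metric.ball_mem_nhds 0 hρ),
      hY0.eventually (Metric.ball_mem_nhds 0 hρ)] with r h3 h4 h5
    have h6 := h _ _ (mem_ball_zero_iff.1 h4) (mem_ball_zero_iff.1 h5)
    rw [dist_zero_right, norm_smul]
    rw [norm_smul, norm_smul] at h3
    calc ‖a r * b r‖ * _ ≤ ‖a r * b r‖ * (ε / (2 * c) * ‖X r‖ * ‖Y r‖) := by gcongr
      _ = ε / (2 * c) * (‖a r‖ * ‖X r‖ * (‖b r‖ * ‖Y r‖)) := by rw [norm_mul]; ring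
      _ ≤ ε / (2 * c) * c := by gcongr
      _ = ε / 2 := by field_simp
      _ < ε := by linarith
  have h3 := h2.add h1
  rw [zero_add] at h3
  refine h3.congr fun r => ?_
  simp only [map_smul, smul_apply, smul_sub, mul_smul]
  abel_nf
  simp only [smul_comm (b r) (a r)]
  abel

/-- On vectors of degree at least `i`, the group law is additive modulo higher degrees. -/
theorem law_layer {i : ℕ} {x y : EuclideanSpace ℝ (Fin N)}
    (hx : DegreeGE 𝔾.deg i x) (hy : DegreeGE 𝔾.deg i y) :
    DegreeGE 𝔾.deg i (𝔾.law x y) ∧ ∀ j, 𝔾.deg j = i → 𝔾.law x y j = x j + y j := by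
  obtain ⟨B, -, hB⟩ := 𝔾.exists_law_expansion
  have hx1 := tendsto_gradedDilation hx
  have hy1 := tendsto_gradedDilation hy
  have hx0 := tendsto_gradedDilation_zero 𝔾.deg_pos x
  have hy0 := tendsto_gradedDilation_zero 𝔾.deg_pos y
  -- With `b = 1` the second argument is not rescaled and tends to `0`, so the bilinear correction
  -- disappears in the limit.
  have h1 := 𝔾.tendsto_law_sub hB hx0 hy0 hx1 (b := fun _ => 1) (by simpa using hy0)
  have h2 := (h1.add hx1).add hy1
  have h3 : Tendsto (fun r : ℝ => (r ^ i)⁻¹ • gradedDilation 𝔾.deg r (𝔾.law x y)) (𝓝[>] 0)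
      (𝓝 (layerPart 𝔾.deg i x + layerPart 𝔾.deg i y)) := by
    rw [map_zero, zero_add] at h2
    refine h2.congr' ?_
    filter_upwards [self_mem_nhdsWithin] with r hr
    rw [𝔾.gradedDilation_law hr, mul_one, ← smul_add, ← smul_add]
    congr 1
    abel
  obtain ⟨h4, h5⟩ := degreeGE_of_tendsto h3
  exact ⟨h4, fun j hj => by simp [h5 j hj, hj]⟩

theorem degreeGE_one (x : EuclideanSpace ℝ (Fin N)) : DegreeGE 𝔾.deg 1 x := fun j hj => by
  have := 𝔾.deg_pos j
  omega

/-- The leading part of a commutator is the Lie bracket of the leading parts. -/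
theorem commutator_layer {i : ℕ} {x y c : EuclideanSpace ℝ (Fin N)}
    (hy : DegreeGE 𝔾.deg i y) (hc : 𝔾.law c (𝔾.law y x) = 𝔾.law x y) :
    DegreeGE 𝔾.deg (i + 1) c ∧ ∀ j, 𝔾.deg j = i + 1 →
      c j = lieAlgebraBracket 𝔾.law (layerPart 𝔾.deg 1 x) (layerPart 𝔾.deg i y) j := by
  obtain ⟨B, hbr, hB⟩ := 𝔾.exists_law_expansion
  apply degreeGE_of_tendsto
  have hx1 := tendsto_gradedDilation (𝔾.degreeGE_one x)
  have hy1 := tendsto_gradedDilation hy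
  have hx0 := tendsto_gradedDilation_zero 𝔾.deg_pos x
  have hy0 := tendsto_gradedDilation_zero 𝔾.deg_pos y
  have hc0 := tendsto_gradedDilation_zero 𝔾.deg_pos c
  have hz0 := tendsto_gradedDilation_zero 𝔾.deg_pos (𝔾.law y x)
  -- The linear terms of `x * y` and `y * x` agree, so their difference at scale `r ^ (i + 1)` tends
  -- to the antisymmetrised bilinear part, the bracket.
  have h1 := (𝔾.tendsto_law_sub hB hx0 hy0 hx1 hy1).sub (𝔾.tendsto_law_sub hB hy0 hx0 hy1 hx1)
  rw [← hbr] at h1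
  have h2 : Tendsto (fun r : ℝ => (r ^ (i + 1))⁻¹ • (gradedDilation 𝔾.deg r (𝔾.law x y) -
      gradedDilation 𝔾.deg r (𝔾.law y x))) (𝓝[>] 0)
      (𝓝 (lieAlgebraBracket 𝔾.law (layerPart 𝔾.deg 1 x) (layerPart 𝔾.deg i y))) := by
    refine h1.congr' ?_
    filter_upwards [self_mem_nhdsWithin] with r hr
    rw [𝔾.gradedDilation_law hr, 𝔾.gradedDilation_law hr, mul_comm (r ^ i)⁻¹, ← smul_sub,
      pow_one, pow_succ', mul_inv]
    congr 1
    abel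
  obtain ⟨ρ, hρ, hB1⟩ := hB 1 one_pos
  set K := 1 + ‖B‖ with hK
  have hK0 : 0 < K := by positivity
  -- the error made in replacing `C * Z` by `C + Z`
  have hsmall : ∀ᶠ r : ℝ in 𝓝[>] 0,
      ‖gradedDilation 𝔾.deg r (𝔾.law x y) - gradedDilation 𝔾.deg r (𝔾.law y x) -
        gradedDilation 𝔾.deg r c‖ ≤
      K * ‖gradedDilation 𝔾.deg r c‖ * ‖gradedDilation 𝔾.deg r (𝔾.law y x)‖ := by
    filter_upwards [self_mem_nhdsWithin, hc0.eventually (Metric.ball_mem_nhds 0 hρ),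
      hz0.eventually (Metric.ball_mem_nhds 0 hρ)] with r hr h3 h4
    set C := gradedDilation 𝔾.deg r c
    set Z := gradedDilation 𝔾.deg r (𝔾.law y x)
    have h5 := hB1 C Z (mem_ball_zero_iff.1 h3) (mem_ball_zero_iff.1 h4)
    rw [← hc, 𝔾.gradedDilation_law hr]
    calc _ = ‖(𝔾.law C Z - C - Z - B C Z) + B C Z‖ := by congr 1; abel
      _ ≤ 1 * ‖C‖ * ‖Z‖ + ‖B‖ * ‖C‖ * ‖Z‖ :=
          (norm_add_le _ _).trans (add_le_add h5 (B.le_opNorm₂ C Z))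
      _ = K * ‖C‖ * ‖Z‖ := by rw [hK]; ring
  -- As `Z → 0`, the error `K * ‖C‖ * ‖Z‖` is absorbed into half of `‖C‖`. This controls `C` by the
  -- difference of the two products, with no decay rate for `C` known beforehand.
  have hhalf : ∀ᶠ r : ℝ in 𝓝[>] 0, ‖gradedDilation 𝔾.deg r c‖ ≤
      2 * ‖gradedDilation 𝔾.deg r (𝔾.law x y) - gradedDilation 𝔾.deg r (𝔾.law y x)‖ := by
    filter_upwards [hsmall, hz0.eventually (Metric.ball_mem_nhds 0
      (show 0 < 1 / (2 * K) by positivity))] with r h3 h4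
    set C := gradedDilation 𝔾.deg r c
    set Z := gradedDilation 𝔾.deg r (𝔾.law y x)
    set D := gradedDilation 𝔾.deg r (𝔾.law x y) - Z
    have h5 : K * ‖C‖ * ‖Z‖ ≤ ‖C‖ / 2 := by
      have := (mem_ball_zero_iff.1 h4).le
      calc K * ‖C‖ * ‖Z‖ ≤ K * ‖C‖ * (1 / (2 * K)) := by gcongr
        _ = ‖C‖ / 2 := by field_simp
    have h6 : ‖C‖ ≤ ‖D‖ + ‖D - C‖ := by
      simpa using norm_sub_le D (D - C)
    linarith
  have h3 : Tendsto (fun r : ℝ => (r ^ (i + 1))⁻¹ • (gradedDilation 𝔾.deg r (𝔾.law x y) -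
      gradedDilation 𝔾.deg r (𝔾.law y x) - gradedDilation 𝔾.deg r c)) (𝓝[>] 0) (𝓝 0) := by
    have h4 := ((h2.norm.const_mul (2 * K)).mul hz0.norm)
    rw [norm_zero, mul_zero] at h4
    refine squeeze_zero_norm' ?_ h4
    filter_upwards [hsmall, hhalf] with r h5 h6
    set C := gradedDilation 𝔾.deg r c
    set Z := gradedDilation 𝔾.deg r (𝔾.law y x)
    set D := gradedDilation 𝔾.deg r (𝔾.law x y) - Z
    rw [norm_smul, norm_smul]
    calc ‖(r ^ (i + 1))⁻¹‖ * ‖D - C‖ ≤ ‖(r ^ (i + 1))⁻¹‖ * (K * (2 * ‖D‖) * ‖Z‖) := by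
          gcongr
          exact h5.trans (by gcongr)
      _ = _ := by ring
  have h4 := h2.sub h3
  rw [sub_zero] at h4
  refine h4.congr fun r => ?_
  rw [← smul_sub]
  congr 1
  abel

/-- The subgroup generated by the horizontal elements is the whole group. -/
theorem closure_horizontal :
    Subgroup.closure (𝔾.coord.symm '' (gradedLayer 𝔾.deg 1 : Set (EuclideanSpace ℝ (Fin N)))) =
      ⊤ := by
  set H := Subgroup.closure
    (𝔾.coord.symm '' (gradedLayer 𝔾.deg 1 : Set (EuclideanSpace ℝ (Fin N)))) with hH
  have hdil : ∀ t : ℝ, 0 < t → ∀ g ∈ H, 𝔾.dilation t g ∈ H := by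
    intro t ht g hg
    let φ : G →* G := MonoidHom.mk' (𝔾.dilation t) (𝔾.dilation_mul' ht)
    have : H ≤ H.comap φ := by
      rw [hH, Subgroup.closure_le]
      rintro _ ⟨v, hv, rfl⟩
      refine Subgroup.subset_closure ⟨gradedDilation 𝔾.deg t v, ?_, 𝔾.symm_gradedDilation t v⟩
      exact mem_gradedLayer.2 fun j hj => by simp [mem_gradedLayer.1 hv j hj]
    exact this hg
  -- the leading parts of degree `i` of elements of `H`
  have hA : ∀ i, 1 ≤ i → ∀ z ∈ gradedLayer 𝔾.deg i, ∃ x, 𝔾.coord.symm x ∈ H ∧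
      DegreeGE 𝔾.deg i x ∧ layerPart 𝔾.deg i x = z := by
    intro i hi
    induction i, hi using Nat.le_induction with
    | base => exact fun z hz =>
        ⟨z, Subgroup.subset_closure ⟨z, hz, rfl⟩, 𝔾.degreeGE_one z, layerPart_of_mem hz⟩
    | succ i hi ih =>
      intro z hz
      rw [← 𝔾.stratified i hi] at hz
      have hneg : ∀ z, (∃ x, 𝔾.coord.symm x ∈ H ∧ DegreeGE 𝔾.deg (i + 1) x ∧
          layerPart 𝔾.deg (i + 1) x = z) → ∃ x, 𝔾.coord.symm x ∈ H ∧
          DegreeGE 𝔾.deg (i + 1) x ∧ layerPart 𝔾.deg (i + 1) x = -z := by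
        rintro z ⟨x, hx, hx1, rfl⟩
        refine ⟨-x, by rw [symm_neg]; exact H.inv_mem hx, fun j hj => by simp [hx1 j hj], ?_⟩
        ext j
        simp [neg_ite]
      have hpos : ∀ (t : ℝ) z, 0 < t → (∃ x, 𝔾.coord.symm x ∈ H ∧ DegreeGE 𝔾.deg (i + 1) x ∧
          layerPart 𝔾.deg (i + 1) x = z) → ∃ x, 𝔾.coord.symm x ∈ H ∧
          DegreeGE 𝔾.deg (i + 1) x ∧ layerPart 𝔾.deg (i + 1) x = t • z := by
        rintro t z ht ⟨x, hx, hx1, rfl⟩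
        -- A dilation by `s` multiplies degree `i + 1` by `s ^ (i + 1)`, hence the root.
        set s : ℝ := t ^ ((i + 1 : ℕ) : ℝ)⁻¹
        have hs : s ^ (i + 1) = t := Real.rpow_inv_natCast_pow ht.le (by omega)
        refine ⟨gradedDilation 𝔾.deg s x, ?_, fun j hj => by simp [hx1 j hj], ?_⟩
        · rw [symm_gradedDilation]
          exact hdil s (Real.rpow_pos_of_pos ht _) _ hx
        · ext j
          by_cases hj : 𝔾.deg j = i + 1
          · simp [hj, hs]
          · simp [hj]
      -- On leading parts, commutators realise brackets, products realise sums, dilations positive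
      -- multiples and inverses signs.
      induction hz using Submodule.span_induction with
      | mem z hz =>
        obtain ⟨v, hv, w, hw, rfl⟩ := hz
        obtain ⟨y, hy, hy1, rfl⟩ := ih w hw
        have hvH : 𝔾.coord.symm v ∈ H := Subgroup.subset_closure ⟨v, hv, rfl⟩
        set g := 𝔾.coord.symm v
        set h := 𝔾.coord.symm y
        obtain ⟨h1, h2⟩ := 𝔾.commutator_layer (x := v) (c := 𝔾.coord (g * h * (h * g)⁻¹)) hy1
          (by rw [law, Equiv.symm_apply_apply, symm_law, inv_mul_cancel_right]; rfl)
        refine ⟨𝔾.coord (g * h * (h * g)⁻¹), ?_, h1, ?_⟩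
        · rw [Equiv.symm_apply_apply]
          exact H.mul_mem (H.mul_mem hvH hy) (H.inv_mem (H.mul_mem hy hvH))
        · have h3 : lieAlgebraBracket 𝔾.law v (layerPart 𝔾.deg i y) ∈
              gradedLayer 𝔾.deg (i + 1) := by
            rw [← 𝔾.stratified i hi]
            exact Submodule.subset_span ⟨v, hv, _, hw, rfl⟩
          ext j
          by_cases hj : 𝔾.deg j = i + 1
          · rw [layerPart_apply, if_pos hj, h2 j hj, layerPart_of_mem hv]
            rfl
          · rw [layerPart_apply, if_neg hj]
            exact (mem_gradedLayer.1 h3 j hj).symm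
      | zero =>
        exact ⟨0, by simp [H.one_mem], fun j _ => by simp, by ext j; simp⟩
      | add z w _ _ hz hw =>
        obtain ⟨x, hx, hx1, rfl⟩ := hz
        obtain ⟨y, hy, hy1, rfl⟩ := hw
        obtain ⟨h1, h2⟩ := 𝔾.law_layer hx1 hy1
        refine ⟨𝔾.law x y, by rw [symm_law]; exact H.mul_mem hx hy, h1, ?_⟩
        ext j
        by_cases hj : 𝔾.deg j = i + 1
        · simp [hj, h2 j hj]
        · simp [hj]
      | smul t z _ hz =>
        rcases lt_trichotomy t 0 with ht | rfl | ht
        · have := hneg _ (hpos (-t) z (by linarith) hz)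
          simpa using this
        · exact ⟨0, by simp [H.one_mem], fun j _ => by simp, by ext j; simp⟩
        · exact hpos t z ht hz
  -- descending induction on the degree
  set s := Finset.univ.sup 𝔾.deg + 1 with hs
  have hdesc : ∀ k i, 1 ≤ i → s ≤ i + k → ∀ x, DegreeGE 𝔾.deg i x → 𝔾.coord.symm x ∈ H := by
    intro k
    induction k with
    | zero =>
      intro i _ hk x hx
      have : x = 0 := by
        ext j
        have : 𝔾.deg j ≤ Finset.univ.sup 𝔾.deg := Finset.le_sup (Finset.mem_univ j)
        exact hx j (by omega)
      rw [this, symm_zero]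
      exact H.one_mem
    | succ k ih =>
      intro i hi hk x hx
      -- Left division by an element of `H` with the same degree `i` part leaves only higher
      -- degrees.
      obtain ⟨y, hy, hy1, hy2⟩ := hA i hi _ (layerPart_mem i x)
      obtain ⟨h1, h2⟩ := 𝔾.law_layer (x := -y) (y := x)
        (fun j hj => by simp [hy1 j hj]) hx
      have h3 := ih (i + 1) (by omega) (by omega) (𝔾.law (-y) x) fun j hj => by
        rcases Nat.lt_succ_iff_lt_or_eq.1 hj with hj | hj
        · exact h1 j hj
        · rw [h2 j hj]
          have := congrArg (fun z : EuclideanSpace ℝ (Fin N) => z j) hy2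
          simp only [layerPart_apply, if_pos hj] at this
          simp [this]
      rw [symm_law, symm_neg] at h3
      simpa using H.mul_mem hy h3
  rw [eq_top_iff]
  intro g _
  have := hdesc s 1 le_rfl (by omega) (𝔾.coord g) (𝔾.degreeGE_one _)
  simpa using this

end CarnotGroup

/-! ### Bounded generation and the horizontal homomorphism -/

namespace CarnotGroup

variable {G : Type*} [Group G] {N : ℕ} (𝔾 : CarnotGroup G N)

open scoped Pointwise in
/-- Some set of products of a bounded number of bounded horizontal elements has interior. -/
theorem exists_interior_pow :
    ∃ k R : ℕ, (interior (𝔾.coord '' ((𝔾.coord.symm ''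
      ((gradedLayer 𝔾.deg 1 : Set (EuclideanSpace ℝ (Fin N))) ∩ Metric.closedBall 0 R)) ^ k :
        Set G))).Nonempty := by
  set A : ℕ → Set G := fun R => 𝔾.coord.symm ''
    ((gradedLayer 𝔾.deg 1 : Set (EuclideanSpace ℝ (Fin N))) ∩ Metric.closedBall 0 R) with hA
  have hmono : Monotone A := fun R S h => image_mono
    (inter_subset_inter_right _ (Metric.closedBall_subset_closedBall (by exact_mod_cast h)))
  have hone : ∀ R, (1 : G) ∈ A R := fun R =>
    ⟨0, ⟨Submodule.zero_mem _, by simp⟩, 𝔾.symm_zero⟩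
  have hinv : ∀ R, (A R)⁻¹ = A R := fun R => by
    have h : ∀ g ∈ A R, g⁻¹ ∈ A R := by
      rintro _ ⟨v, ⟨hv, hv'⟩, rfl⟩
      exact ⟨-v, ⟨Submodule.neg_mem _ hv, by simpa using hv'⟩, 𝔾.symm_neg v⟩
    ext g
    exact ⟨fun hg => by simpa using h _ hg, fun hg => h _ hg⟩
  -- Compactness is taken in coordinates, since the metric topology has not yet been compared with
  -- the Euclidean one.
  have hcompact : ∀ R k, IsCompact (𝔾.coord '' (A R ^ k)) := by
    intro R k
    have h1 : IsCompact (𝔾.coord '' A R) := by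
      rw [hA, 𝔾.coord.image_symm_image]
      exact (isCompact_closedBall _ _).inter_left (Submodule.closed_of_finiteDimensional _)
    induction k with
    | zero => simp
    | succ k ih =>
      have : 𝔾.coord '' (A R ^ (k + 1)) = (fun p => 𝔾.law p.1 p.2) ''
          ((𝔾.coord '' (A R ^ k)) ×ˢ (𝔾.coord '' A R)) := by
        ext z
        simp only [pow_succ, mem_image, Set.mem_mul, mem_prod, Prod.exists]
        constructor
        · rintro ⟨_, ⟨g, hg, h, hh, rfl⟩, rfl⟩
          exact ⟨_, _, ⟨⟨g, hg, rfl⟩, ⟨h, hh, rfl⟩⟩, (𝔾.coord_mul g h).symm⟩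
        · rintro ⟨_, _, ⟨⟨g, hg, rfl⟩, ⟨h, hh, rfl⟩⟩, rfl⟩
          exact ⟨_, ⟨g, hg, h, hh, rfl⟩, 𝔾.coord_mul g h⟩
      rw [this]
      exact (ih.prod h1).image 𝔾.continuous_law
  have hunion : ∀ g : G, ∃ R k, g ∈ A R ^ k := by
    intro g
    have hg : g ∈ Subgroup.closure (𝔾.coord.symm ''
        (gradedLayer 𝔾.deg 1 : Set (EuclideanSpace ℝ (Fin N)))) := by
      rw [closure_horizontal]; trivial
    induction hg using Subgroup.closure_induction with
    | mem g hg =>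
      obtain ⟨v, hv, rfl⟩ := hg
      obtain ⟨R, hR⟩ := exists_nat_ge ‖v‖
      exact ⟨R, 1, by rw [pow_one]; exact ⟨v, ⟨hv, by simpa using hR⟩, rfl⟩⟩
    | one => exact ⟨0, 0, by simp⟩
    | mul g h _ _ hg hh =>
      obtain ⟨R, k, hg⟩ := hg
      obtain ⟨S, l, hh⟩ := hh
      refine ⟨max R S, k + l, ?_⟩
      rw [pow_add]
      exact mul_mem_mul (pow_le_pow_left' (hmono (le_max_left R S)) k hg)
        (pow_le_pow_left' (hmono (le_max_right R S)) l hh)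
    | inv g _ hg =>
      obtain ⟨R, k, hg⟩ := hg
      refine ⟨R, k, ?_⟩
      rw [← hinv R, inv_pow]
      exact Set.inv_mem_inv.2 hg
  -- Baire: countably many closed sets cover `ℝ^N`, so one of them has interior.
  obtain ⟨⟨k, R⟩, h⟩ := nonempty_interior_of_iUnion_of_closed
    (f := fun p : ℕ × ℕ => 𝔾.coord '' (A p.2 ^ p.1)) (fun p => (hcompact _ _).isClosed) (by
      rw [eq_univ_iff_forall]
      intro x
      obtain ⟨R, k, h⟩ := hunion (𝔾.coord.symm x)
      exact mem_iUnion.2 ⟨(k, R), _, h, by simp⟩)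
  exact ⟨k, R, h⟩

variable {𝔾}

theorem norm_layerPart_one (x : EuclideanSpace ℝ (Fin N)) :
    ‖layerPart 𝔾.deg 1 x‖ = ‖𝔾.horizontal (𝔾.coord.symm x)‖ := by
  rw [EuclideanSpace.norm_eq, EuclideanSpace.norm_eq]
  congr 1
  simp only [layerPart_apply, horizontal, Equiv.apply_symm_apply]
  rw [← Finset.sum_filter_of_ne (p := fun j => 𝔾.deg j = 1) (fun j _ h => by
    by_contra hj; simp [hj] at h)]
  rw [Finset.sum_subtype (p := fun j => 𝔾.deg j = 1) _ (by simp)]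
  exact Finset.sum_congr rfl fun j _ => by simp [j.2]

theorem horizontal_apply (g : G) (j : {j : Fin N // 𝔾.deg j = 1}) :
    𝔾.horizontal g j = 𝔾.coord g j := rfl

theorem horizontal_mul (g h : G) :
    𝔾.horizontal (g * h) = 𝔾.horizontal g + 𝔾.horizontal h := by
  ext j
  have := (𝔾.law_layer (𝔾.degreeGE_one (𝔾.coord g)) (𝔾.degreeGE_one (𝔾.coord h))).2 j j.2
  rw [← coord_mul] at this
  exact this

theorem horizontal_inv (g : G) : 𝔾.horizontal g⁻¹ = -𝔾.horizontal g := by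
  ext j
  simp [horizontal_apply, coord_inv]

theorem horizontal_dilation (t : ℝ) (g : G) :
    𝔾.horizontal (𝔾.dilation t g) = t • 𝔾.horizontal g := by
  ext j
  simp [horizontal_apply, coord_dilation, j.2]

/-! ### The homogeneous metric against the Euclidean topology -/

section Metric

variable [MetricSpace G]

theorem IsHomogeneousMetric.dist_eq (hd : 𝔾.IsHomogeneousMetric) (g h : G) :
    dist g h = dist (g⁻¹ * h) 1 := by
  rw [← hd.left_invariant g⁻¹ g h, inv_mul_cancel, dist_comm]

theorem IsHomogeneousMetric.dist_mul_le (hd : 𝔾.IsHomogeneousMetric) (g h : G) :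
    dist (g * h) 1 ≤ dist g 1 + dist h 1 := by
  calc dist (g * h) 1 ≤ dist (g * h) g + dist g 1 := dist_triangle _ _ _
    _ = dist h 1 + dist g 1 := by
      rw [← hd.left_invariant g h 1, mul_one]
    _ = _ := add_comm _ _

theorem IsHomogeneousMetric.dist_pow_le (hd : 𝔾.IsHomogeneousMetric) (g : G) (k : ℕ) :
    dist (g ^ k) 1 ≤ k * dist g 1 := by
  induction k with
  | zero => simp
  | succ k ih =>
    rw [pow_succ]
    push_cast
    linarith [hd.dist_mul_le (g ^ k) g]

theorem IsHomogeneousMetric.dist_dilation (hd : 𝔾.IsHomogeneousMetric) {t : ℝ} (ht : 0 < t)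
    (g : G) : dist (𝔾.dilation t g) 1 = t * dist g 1 := by
  rw [← hd.homogeneous t ht g 1, dilation_one]

-- A product of `k` horizontal elements of norm at most `R` lies within `k * R` of the identity.
-- Such products fill a neighbourhood of some `p`; translating it back to the identity costs one
-- more `k * R`.
open scoped Pointwise in
theorem exists_dist_le_near_zero (hd : 𝔾.IsHomogeneousMetric) (hd1 : 𝔾.IsNormalizedMetric) :
    ∃ C : ℝ, ∀ᶠ x in 𝓝 (0 : EuclideanSpace ℝ (Fin N)), dist (𝔾.coord.symm x) 1 ≤ C := by
  obtain ⟨k, R, p, hp⟩ := 𝔾.exists_interior_pow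
  set A := 𝔾.coord.symm ''
    ((gradedLayer 𝔾.deg 1 : Set (EuclideanSpace ℝ (Fin N))) ∩ Metric.closedBall 0 (R : ℝ))
  have hbound : ∀ k : ℕ, ∀ g ∈ A ^ k, dist g 1 ≤ k * R := by
    intro k
    induction k with
    | zero => intro g hg; simp at hg; simp [hg]
    | succ k ih =>
      intro g hg
      rw [pow_succ] at hg
      obtain ⟨g, hg', _, ⟨v, ⟨hv, hv'⟩, rfl⟩, rfl⟩ := Set.mem_mul.1 hg
      have h1 := hd.dist_mul_le g (𝔾.coord.symm v)
      rw [hd1 v hv] at h1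
      rw [mem_closedBall_zero_iff] at hv'
      push_cast
      linarith [ih g hg']
  have hb : ∀ x ∈ 𝔾.coord '' (A ^ k), dist (𝔾.coord.symm x) 1 ≤ k * R := by
    rintro _ ⟨g, hg, rfl⟩
    simpa using hbound k g hg
  refine ⟨k * R + k * R, ?_⟩
  have hcont : Continuous fun x => 𝔾.law p x :=
    𝔾.continuous_law.comp (continuous_const.prodMk continuous_id)
  have h0 : Tendsto (fun x => 𝔾.law p x) (𝓝 0) (𝓝 p) := by
    simpa using hcont.tendsto 0
  filter_upwards [h0.eventually (mem_interior_iff_mem_nhds.1 hp)] with x hx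
  have h1 := hb _ hx
  have h2 := hb p (interior_subset hp)
  rw [symm_law] at h1
  calc dist (𝔾.coord.symm x) 1 = dist (𝔾.coord.symm p * 𝔾.coord.symm x) (𝔾.coord.symm p) := by
        rw [← hd.left_invariant (𝔾.coord.symm p) _ 1, mul_one]
    _ ≤ _ := (dist_triangle_right _ _ 1).trans (add_le_add h1 h2)

/-- Homogeneity upgrades boundedness to smallness: for `x` near `0` the dilate of `x` by `t⁻¹` is
still in the region where the distance is at most `C`, so that of `x` is at most `t * C`. -/
theorem tendsto_dist_zero (hd : 𝔾.IsHomogeneousMetric) (hd1 : 𝔾.IsNormalizedMetric) :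
    Tendsto (fun x => dist (𝔾.coord.symm x) 1) (𝓝 0) (𝓝 0) := by
  obtain ⟨C, hC⟩ := exists_dist_le_near_zero hd hd1
  rw [Metric.tendsto_nhds]
  intro ε hε
  set t := ε / (|C| + 1) with ht
  have ht0 : 0 < t := by positivity
  have hcont : Continuous fun x => gradedDilation 𝔾.deg t⁻¹ x :=
    continuous_gradedDilation.comp (continuous_const.prodMk continuous_id)
  have h0 : Tendsto (fun x => gradedDilation 𝔾.deg t⁻¹ x) (𝓝 0) (𝓝 0) := by
    have : gradedDilation 𝔾.deg t⁻¹ 0 = 0 := by ext j; simp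
    simpa [this] using hcont.tendsto 0
  filter_upwards [h0.eventually hC] with x hx
  rw [symm_gradedDilation, hd.dist_dilation (inv_pos.2 ht0)] at hx
  rw [dist_zero_right, Real.norm_of_nonneg dist_nonneg]
  have h1 : dist (𝔾.coord.symm x) 1 ≤ t * |C| := by
    have := mul_le_mul_of_nonneg_left (hx.trans (le_abs_self C)) ht0.le
    rwa [mul_inv_cancel_left₀ ht0.ne'] at this
  calc _ ≤ t * |C| := h1
    _ < t * (|C| + 1) := by gcongr; linarith
    _ = ε := by rw [ht]; field_simp

/-- The distance to the identity is continuous for the Euclidean topology. -/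
theorem continuous_dist_one (hd : 𝔾.IsHomogeneousMetric) (hd1 : 𝔾.IsNormalizedMetric) :
    Continuous fun x => dist (𝔾.coord.symm x) 1 := by
  refine continuous_iff_continuousAt.2 fun x => ?_
  have hcont : Continuous fun y => 𝔾.law (-x) y :=
    𝔾.continuous_law.comp (continuous_const.prodMk continuous_id)
  have h0 : Tendsto (fun y => 𝔾.law (-x) y) (𝓝 x) (𝓝 0) := by
    have : 𝔾.law (-x) x = 0 := by simp [law, symm_neg]
    simpa [this] using hcont.tendsto x
  have h1 := (tendsto_dist_zero hd hd1).comp h0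
  rw [ContinuousAt, tendsto_iff_dist_tendsto_zero]
  refine squeeze_zero (fun _ => dist_nonneg) (fun y => ?_) h1
  rw [Real.dist_eq, Function.comp_apply, symm_law, symm_neg, ← hd.dist_eq,
    dist_comm _ (𝔾.coord.symm y)]
  exact abs_dist_sub_le _ _ _

/-- Balls of the homogeneous metric are bounded in exponential coordinates. -/
theorem exists_coord_bound (hd : 𝔾.IsHomogeneousMetric) (hd1 : 𝔾.IsNormalizedMetric) (r : ℝ) :
    ∃ C : ℝ, ∀ g : G, dist g 1 ≤ r → ‖𝔾.coord g‖ ≤ C := by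
  have hcont := continuous_dist_one hd hd1
  obtain ⟨c, hc, hmin⟩ : ∃ c > 0, ∀ x ∈ Metric.sphere (0 : EuclideanSpace ℝ (Fin N)) 1,
      c ≤ dist (𝔾.coord.symm x) 1 :=
    (isCompact_sphere _ _).exists_forall_le' hcont.continuousOn fun x hx => by
      refine dist_pos.2 fun h => ?_
      rw [← 𝔾.symm_zero, 𝔾.coord.symm.injective.eq_iff] at h
      simp [h] at hx
  -- A point outside the unit ball is contracted onto the sphere by some `t`, where `c ≤ t * r`. It
  -- is therefore a dilate, by a factor at most `r / c`, of a point of the sphere, and such dilates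
  -- form a compact set.
  obtain ⟨C, hC⟩ := (((isCompact_Icc (a := (0 : ℝ)) (b := r / c)).prod
    (isCompact_sphere (0 : EuclideanSpace ℝ (Fin N)) 1)).image
      (continuous_gradedDilation (deg := 𝔾.deg))).isBounded.exists_norm_le
  refine ⟨max C 1, fun g hg => ?_⟩
  rcases le_or_gt ‖𝔾.coord g‖ 1 with h | h
  · exact h.trans (le_max_right _ _)
  · have h1 : Continuous fun t : ℝ => ‖gradedDilation 𝔾.deg t (𝔾.coord g)‖ :=
      (continuous_gradedDilation.comp (continuous_id.prodMk continuous_const)).norm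
    have h0 : gradedDilation 𝔾.deg 0 (𝔾.coord g) = 0 := by
      ext j
      have := 𝔾.deg_pos j
      simp [show 𝔾.deg j ≠ 0 by omega]
    obtain ⟨t, ⟨ht0, ht1⟩, ht⟩ := intermediate_value_Icc (zero_le_one (α := ℝ)) h1.continuousOn
      (show (1 : ℝ) ∈ Icc _ _ by simp [h0, gradedDilation_one, h.le])
    have htpos : 0 < t := by
      refine lt_of_le_of_ne ht0 fun h => ?_
      simp [← h, h0] at ht
    refine (hC _ ⟨(t⁻¹, gradedDilation 𝔾.deg t (𝔾.coord g)), ⟨⟨by positivity, ?_⟩, ?_⟩, ?_⟩).trans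
      (le_max_left _ _)
    · have h2 := hmin (gradedDilation 𝔾.deg t (𝔾.coord g)) (by simpa using ht)
      rw [symm_gradedDilation, hd.dist_dilation htpos, Equiv.symm_apply_apply] at h2
      have h3 : c ≤ t * r := h2.trans (by gcongr)
      change t⁻¹ ≤ r / c
      rw [le_div_iff₀ hc, inv_mul_le_iff₀ htpos]
      exact h3
    · simpa using ht
    · simp only
      rw [gradedDilation_gradedDilation, inv_mul_cancel₀ htpos.ne', gradedDilation_one]

/-- Since `g ^ k` has coordinates `k • x`, its dilate by `k⁻¹` multiplies the coordinate `j` by `k ^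
(1 - deg j)` and converges to the horizontal part, whose distance to the identity is its norm. The
triangle inequality keeps all these dilates within `dist g 1`. -/
theorem norm_horizontal_le (hd : 𝔾.IsHomogeneousMetric) (hd1 : 𝔾.IsNormalizedMetric) (g : G) :
    ‖𝔾.horizontal g‖ ≤ dist g 1 := by
  set x := 𝔾.coord g
  have hlim : Tendsto (fun k : ℕ => gradedDilation 𝔾.deg (k : ℝ)⁻¹ ((k : ℝ) • x)) atTop
      (𝓝 (layerPart 𝔾.deg 1 x)) := by
    refine ((tendsto_gradedDilation (𝔾.degreeGE_one x)).comp
      (tendsto_inv_atTop_nhdsGT_zero.comp tendsto_natCast_atTop_atTop)).congr fun k => ?_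
    ext j
    simp
    ring
  have h1 := ((continuous_dist_one hd hd1).tendsto _).comp hlim
  rw [hd1 _ (layerPart_mem 1 x), norm_layerPart_one, Equiv.symm_apply_apply] at h1
  refine le_of_tendsto h1 ?_
  filter_upwards [eventually_gt_atTop 0] with k hk
  have hk' : (0 : ℝ) < k := by exact_mod_cast hk
  rw [Function.comp_apply, symm_gradedDilation, hd.dist_dilation (inv_pos.2 hk'), symm_nsmul,
    Equiv.symm_apply_apply, inv_mul_le_iff₀ hk']
  exact hd.dist_pow_le g k

theorem norm_horizontal_sub_le (hd : 𝔾.IsHomogeneousMetric) (hd1 : 𝔾.IsNormalizedMetric)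
    (g h : G) : ‖𝔾.horizontal g - 𝔾.horizontal h‖ ≤ dist g h := by
  rw [dist_comm, hd.dist_eq]
  refine le_trans (le_of_eq ?_) (norm_horizontal_le hd hd1 _)
  rw [horizontal_mul, horizontal_inv, neg_add_eq_sub]

end Metric

end CarnotGroup

/-! ### The metric derivative of a Lipschitz curve -/

theorem EuclideanSpace.norm_le_norm_of_abs_le {n : Type*} [Fintype n] {x y : EuclideanSpace ℝ n}
    (h : ∀ j, |x j| ≤ |y j|) : ‖x‖ ≤ ‖y‖ := by
  rw [EuclideanSpace.norm_eq, EuclideanSpace.norm_eq]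
  refine Real.sqrt_le_sqrt (Finset.sum_le_sum fun j _ => ?_)
  rw [Real.norm_eq_abs, Real.norm_eq_abs]
  exact pow_le_pow_left₀ (abs_nonneg _) (h j) 2

namespace CarnotGroup

variable {G : Type*} [Group G] {N : ℕ} {𝔾 : CarnotGroup G N}

/-- The non-horizontal part of a dilated vector is of second order. -/
theorem norm_sub_layerPart_le {t : ℝ} (ht0 : 0 ≤ t) (ht1 : t ≤ 1)
    (x : EuclideanSpace ℝ (Fin N)) :
    ‖gradedDilation 𝔾.deg t x - layerPart 𝔾.deg 1 (gradedDilation 𝔾.deg t x)‖ ≤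
      t ^ 2 * ‖x‖ := by
  calc _ ≤ ‖t ^ 2 • x‖ := by
        refine EuclideanSpace.norm_le_norm_of_abs_le fun j => ?_
        by_cases hj : 𝔾.deg j = 1
        · simp only [PiLp.sub_apply, layerPart_apply, if_pos hj, sub_self, abs_zero]
          exact abs_nonneg _
        · have h2 : 2 ≤ 𝔾.deg j := by have := 𝔾.deg_pos j; omega
          simp only [PiLp.sub_apply, gradedDilation_apply, layerPart_apply, if_neg hj, sub_zero,
            PiLp.smul_apply, smul_eq_mul, abs_mul, abs_pow, abs_of_nonneg ht0]
          gcongr ?_ * _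
          exact pow_le_pow_of_le_one ht0 ht1 h2
    _ = t ^ 2 * ‖x‖ := by rw [norm_smul, Real.norm_of_nonneg (by positivity)]

/-- Translations are not Euclidean isometries; this bounds, uniformly on bounded sets, the Euclidean
cost of changing the middle factor of a product. -/
theorem exists_lipschitz_triple (𝔾 : CarnotGroup G N) (R : ℝ) :
    ∃ L : ℝ≥0, ∀ x y y' z : EuclideanSpace ℝ (Fin N), ‖x‖ ≤ R → ‖y‖ ≤ R → ‖y'‖ ≤ R → ‖z‖ ≤ R →
      ‖𝔾.law (𝔾.law x y) z - 𝔾.law (𝔾.law x y') z‖ ≤ L * ‖y - y'‖ := by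
  set T : EuclideanSpace ℝ (Fin N) × EuclideanSpace ℝ (Fin N) × EuclideanSpace ℝ (Fin N) →
    EuclideanSpace ℝ (Fin N) := fun p => 𝔾.law (𝔾.law p.1 p.2.1) p.2.2
  have hT : ContDiff ℝ 1 T := by
    have h1 : ContDiff ℝ ∞ T :=
      𝔾.contDiff_law.comp ((𝔾.contDiff_law.comp
        (contDiff_fst.prodMk (contDiff_fst.comp contDiff_snd))).prodMk
          (contDiff_snd.comp contDiff_snd))
    exact h1.of_le (by norm_cast)
  obtain ⟨L, hL⟩ := hT.locallyLipschitz.locallyLipschitzOn.exists_lipschitzOnWith_of_compact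
    (isCompact_closedBall (0 : EuclideanSpace ℝ (Fin N) × EuclideanSpace ℝ (Fin N) ×
      EuclideanSpace ℝ (Fin N)) R)
  refine ⟨L, fun x y y' z hx hy hy' hz => ?_⟩
  have := hL.dist_le_mul (x, y, z) (by simp [Prod.norm_def, hx, hy, hz]) (x, y', z)
    (by simp [Prod.norm_def, hx, hy', hz])
  simpa [T, dist_eq_norm, Prod.norm_def] using this

variable [MetricSpace G]

/-- A chain of many short steps whose horizontal parts are close to `w / k` ends up close to
`exp w`. -/
theorem exists_chain_bound (hd : 𝔾.IsHomogeneousMetric) (hd1 : 𝔾.IsNormalizedMetric)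
    {w : EuclideanSpace ℝ (Fin N)} (hw : w ∈ gradedLayer 𝔾.deg 1) (K : ℝ≥0) {ε : ℝ} (hε : 0 < ε) :
    ∃ k : ℕ, 0 < k ∧ ∃ δ > 0, ∀ p : ℕ → G, p 0 = 1 →
      (∀ i < k, dist (p i) (p (i + 1)) ≤ K / k) →
      (∀ i < k, ‖𝔾.horizontal (p (i + 1)) - 𝔾.horizontal (p i) -
        (k : ℝ)⁻¹ • 𝔾.horizontal (𝔾.coord.symm w)‖ ≤ δ) →
      dist (p k) 1 ≤ ‖w‖ + ε := by
  obtain ⟨ρ, hρ, hball⟩ := Metric.eventually_nhds_iff.1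
    (((continuous_dist_one hd hd1).tendsto w).eventually
      (gt_mem_nhds (show _ < dist (𝔾.coord.symm w) 1 + ε by linarith)))
  obtain ⟨C, hC⟩ := exists_coord_bound hd hd1 K
  obtain ⟨L, hL⟩ := 𝔾.exists_lipschitz_triple (max C ‖w‖)
  have hC0 : 0 ≤ C := (norm_nonneg _).trans (hC 1 (by simp))
  -- This `k` keeps the accumulated vertical error `k * L * C / k²` below `ρ / 2`; then `δ` keeps
  -- the horizontal one `k * L * δ` at most `ρ / 4`.
  obtain ⟨k, hk⟩ := exists_nat_gt (max 1 (4 * (L * C) / ρ))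
  have hk1 : (1 : ℝ) < k := (le_max_left _ _).trans_lt hk
  have hk0 : (0 : ℝ) < k := by linarith
  have hkC : 4 * (L * C) / ρ < k := (le_max_right _ _).trans_lt hk
  have hkN : 0 < k := by exact_mod_cast hk0
  set δ := ρ / (4 * (L + 1) * k) with hδ
  refine ⟨k, hkN, δ, by positivity, fun p hp0 hp1 hp2 => ?_⟩
  have hpdist : ∀ i ≤ k, dist (p i) 1 ≤ K := fun i hi => by
    have h1 := dist_le_range_sum_of_dist_le (f := p) (d := fun _ => (K : ℝ) / k) i
      fun hj => hp1 _ (by omega)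
    rw [hp0, dist_comm, Finset.sum_const, Finset.card_range, nsmul_eq_mul] at h1
    refine h1.trans ?_
    rw [mul_div_left_comm]
    exact mul_le_of_le_one_right K.2 ((div_le_one hk0).2 (by exact_mod_cast hi))
  -- The path follows the chain up to step `i` and finishes with the straight piece `exp ((k - i) /
  -- k • w)`. It interpolates between `w` and `p k`, and consecutive terms differ in a single middle
  -- factor.
  set q : ℕ → EuclideanSpace ℝ (Fin N) := fun i =>
    𝔾.law (𝔾.coord (p i)) ((((k : ℝ) - i) / k) • w) with hq
  have hstep : ∀ i < k, dist (q i) (q (i + 1)) ≤ L * (δ + (k : ℝ)⁻¹ ^ 2 * C) := by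
    intro i hi
    set g := (p i)⁻¹ * p (i + 1) with hg
    have hi' : (i : ℝ) + 1 ≤ k := by exact_mod_cast hi
    set z := (((k : ℝ) - (i + 1 : ℕ)) / k) • w with hz
    have hsmul : ∀ s : ℝ, 0 ≤ s → s ≤ 1 → ‖s • w‖ ≤ max C ‖w‖ := fun s h0 h1 => by
      rw [norm_smul, Real.norm_of_nonneg h0]
      exact (mul_le_of_le_one_left (norm_nonneg _) h1).trans (le_max_right _ _)
    have hgd : dist g 1 ≤ K / k := by
      rw [hg, ← hd.dist_eq]
      exact hp1 i hi
    have hgC : ‖𝔾.coord g‖ ≤ C := hC g (hgd.trans (div_le_self K.2 hk1.le))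
    have hq1 : q (i + 1) = 𝔾.law (𝔾.law (𝔾.coord (p i)) (𝔾.coord g)) z := by
      simp only [hq]
      rw [← coord_mul, hg, mul_inv_cancel_left]
    have hq0 : q i = 𝔾.law (𝔾.law (𝔾.coord (p i)) ((k : ℝ)⁻¹ • w)) z := by
      have h1 : ((k : ℝ) - i) / k = (k : ℝ)⁻¹ + ((k : ℝ) - (i + 1 : ℕ)) / k := by
        push_cast
        field_simp
        ring
      simp only [hq]
      rw [h1]
      simp only [law, Equiv.symm_apply_apply, 𝔾.exponential, hz, mul_assoc]
    have hzn : ‖z‖ ≤ max C ‖w‖ := by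
      refine hsmul _ (div_nonneg ?_ hk0.le) ((div_le_one hk0).2 ?_)
      · push_cast; linarith
      · push_cast; linarith [(Nat.cast_nonneg i : (0 : ℝ) ≤ i)]
    rw [hq0, hq1, dist_comm, dist_eq_norm]
    refine (hL _ _ _ _ ((hC _ (hpdist i hi.le)).trans (le_max_left _ _))
      (hgC.trans (le_max_left _ _))
      (hsmul _ (by positivity) (inv_le_one_of_one_le₀ hk1.le)) hzn).trans ?_
    gcongr
    set u := 𝔾.coord g - (k : ℝ)⁻¹ • w with hu
    have hu1 : ‖layerPart 𝔾.deg 1 u‖ ≤ δ := by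
      rw [norm_layerPart_one]
      refine le_trans (le_of_eq ?_) (hp2 i hi)
      congr 1
      ext j
      have h1 : 𝔾.horizontal g = 𝔾.horizontal (p (i + 1)) - 𝔾.horizontal (p i) := by
        rw [hg, horizontal_mul, horizontal_inv, neg_add_eq_sub]
      rw [← h1]
      simp [horizontal_apply, hu]
    -- Dilated by `k`, the step `g` lies in the ball of radius `K`, so its coordinates are bounded
    -- by `C`; dilating back gains `k⁻²` off the first layer.
    have hu2 : ‖u - layerPart 𝔾.deg 1 u‖ ≤ (k : ℝ)⁻¹ ^ 2 * C := by
      have h1 : 𝔾.coord g = gradedDilation 𝔾.deg (k : ℝ)⁻¹ (𝔾.coord (𝔾.dilation k g)) := by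
        rw [coord_dilation, gradedDilation_gradedDilation, inv_mul_cancel₀ hk0.ne',
          gradedDilation_one]
      have h2 : ‖𝔾.coord (𝔾.dilation k g)‖ ≤ C := by
        refine hC _ ?_
        rw [hd.dist_dilation hk0]
        calc (k : ℝ) * dist g 1 ≤ k * (K / k) := by gcongr
          _ = K := by field_simp
      have h3 : u - layerPart 𝔾.deg 1 u = 𝔾.coord g - layerPart 𝔾.deg 1 (𝔾.coord g) := by
        ext j
        by_cases hj : 𝔾.deg j = 1
        · simp [hj]
        · simp [hj, hu, mem_gradedLayer.1 hw j hj]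
      rw [h3, h1]
      exact (norm_sub_layerPart_le (by positivity) (inv_le_one_of_one_le₀ hk1.le) _).trans
        (by gcongr)
    calc ‖u‖ = ‖layerPart 𝔾.deg 1 u + (u - layerPart 𝔾.deg 1 u)‖ := by congr 1; abel
      _ ≤ _ := (norm_add_le _ _).trans (add_le_add hu1 hu2)
  have hsum := dist_le_range_sum_of_dist_le (f := q)
    (d := fun _ => L * (δ + (k : ℝ)⁻¹ ^ 2 * C)) k fun hj => hstep _ hj
  have hq0 : q 0 = w := by simp [hq, hp0, hk0.ne']
  have hqk : q k = 𝔾.coord (p k) := by simp [hq]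
  rw [hq0, hqk, Finset.sum_const, Finset.card_range, nsmul_eq_mul] at hsum
  have hfin : (k : ℝ) * (L * (δ + (k : ℝ)⁻¹ ^ 2 * C)) < ρ := by
    have h1 : (k : ℝ) * (L * (δ + (k : ℝ)⁻¹ ^ 2 * C)) = ρ / 4 * (L / (L + 1)) + L * C / k := by
      rw [hδ]
      field_simp
    have h2 : (L : ℝ) / (L + 1) ≤ 1 := (div_le_one (by positivity)).2 (by linarith)
    have h3 : L * C / k < ρ / 2 := by
      rw [div_lt_iff₀ hρ] at hkC
      rw [div_lt_iff₀ hk0]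
      have : (0 : ℝ) ≤ L * C := by positivity
      nlinarith
    rw [h1]
    nlinarith
  have := hball (y := 𝔾.coord (p k)) (by rw [dist_comm]; exact hsum.trans_lt hfin)
  rw [Equiv.symm_apply_apply, hd1 w hw] at this
  exact this.le

/-- Dilating the increments of `γ` from `t` by `s⁻¹` gives a chain to which `exists_chain_bound`
applies. Its length `k` is fixed before `s → 0`, so the remainder of the derivative is eventually
small on each step. The sign `σ` selects the side of `t`. -/
theorem dist_le_of_hasDerivAt (hd : 𝔾.IsHomogeneousMetric) (hd1 : 𝔾.IsNormalizedMetric)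
    {γ : ℝ → G} {K : ℝ≥0} (hγ : LipschitzWith K γ) {t : ℝ}
    {v : EuclideanSpace ℝ {j : Fin N // 𝔾.deg j = 1}}
    (hv : HasDerivAt (fun u => 𝔾.horizontal (γ u)) v t) {σ : ℝ} (hσ : |σ| = 1) {ε : ℝ}
    (hε : 0 < ε) :
    ∀ᶠ s in 𝓝[>] (0 : ℝ), dist (γ (t + σ * s)) (γ t) ≤ s * (‖v‖ + ε) := by
  set w₀ : EuclideanSpace ℝ (Fin N) :=
    WithLp.toLp 2 (fun j => if h : 𝔾.deg j = 1 then v ⟨j, h⟩ else 0) with hw₀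
  have hw₀m : w₀ ∈ gradedLayer 𝔾.deg 1 := mem_gradedLayer.2 fun j hj => by simp [hw₀, hj]
  have hhor : 𝔾.horizontal (𝔾.coord.symm (σ • w₀)) = σ • v := by
    ext j
    simp [horizontal_apply, hw₀, j.2]
  have hnorm : ‖σ • w₀‖ = ‖v‖ := by
    rw [← layerPart_of_mem (Submodule.smul_mem _ σ hw₀m), norm_layerPart_one, hhor, norm_smul,
      Real.norm_eq_abs, hσ, one_mul]
  obtain ⟨k, hk, δ, hδ, hchain⟩ :=
    exists_chain_bound hd hd1 (Submodule.smul_mem _ σ hw₀m) K hε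
  have hk0 : (0 : ℝ) < k := by exact_mod_cast hk
  -- The half is needed because each horizontal step is a difference of two remainders.
  obtain ⟨r, hr, hder⟩ := Metric.eventually_nhds_iff.1
    ((hasDerivAt_iff_isLittleO_nhds_zero.1 hv).def (show 0 < δ / 2 by positivity))
  filter_upwards [self_mem_nhdsWithin, mem_nhdsWithin_of_mem_nhds (Iio_mem_nhds hr)] with s hs hsr
  have hs0 : (0 : ℝ) < s := hs
  set τ : ℕ → ℝ := fun i => σ * s * (i / k) with hτ
  set p : ℕ → G := fun i => 𝔾.dilation s⁻¹ ((γ t)⁻¹ * γ (t + τ i)) with hp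
  have hτabs : ∀ i ≤ k, |τ i| ≤ s := fun i hi => by
    have h1 : (i : ℝ) / k ≤ 1 := (div_le_one hk0).2 (by exact_mod_cast hi)
    rw [hτ]
    simp only [abs_mul, hσ, one_mul, abs_of_pos hs0]
    rw [abs_of_nonneg (by positivity)]
    exact mul_le_of_le_one_right hs0.le h1
  have hτd : ∀ i, τ (i + 1) - τ i = σ * s * (k : ℝ)⁻¹ := fun i => by
    simp only [hτ]
    push_cast
    field_simp
    ring
  have hclose : ∀ i ≤ k, ‖𝔾.horizontal (γ (t + τ i)) - 𝔾.horizontal (γ t) - τ i • v‖ ≤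
      δ / 2 * s := fun i hi => by
    have h1 := hder (y := τ i) (by rw [dist_zero_right]; exact (hτabs i hi).trans_lt hsr)
    refine h1.trans ?_
    gcongr
    exact hτabs i hi
  have h := hchain p ?_ ?_ ?_
  · have h1 : p k = 𝔾.dilation s⁻¹ ((γ t)⁻¹ * γ (t + σ * s)) := by
      simp [hp, hτ, hk0.ne']
    rw [h1, hd.dist_dilation (inv_pos.2 hs0), ← hd.dist_eq, hnorm, inv_mul_le_iff₀ hs0,
      dist_comm] at h
    exact h
  · simp [hp, hτ, dilation_one]
  · intro i hi
    rw [hp]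
    simp only
    rw [hd.homogeneous _ (inv_pos.2 hs0), hd.left_invariant]
    have h1 := hγ.dist_le_mul (t + τ i) (t + τ (i + 1))
    rw [dist_add_left, dist_comm (τ i), Real.dist_eq, hτd, abs_mul, abs_mul, hσ, abs_of_pos hs0,
      abs_of_pos (inv_pos.2 hk0)] at h1
    rw [inv_mul_le_iff₀ hs0]
    exact h1.trans (le_of_eq (by ring))
  · intro i hi
    rw [hhor]
    simp only [hp, horizontal_dilation, horizontal_mul, horizontal_inv]
    have h1 : s⁻¹ • (-𝔾.horizontal (γ t) + 𝔾.horizontal (γ (t + τ (i + 1)))) -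
        s⁻¹ • (-𝔾.horizontal (γ t) + 𝔾.horizontal (γ (t + τ i))) - (k : ℝ)⁻¹ • σ • v =
        s⁻¹ • ((𝔾.horizontal (γ (t + τ (i + 1))) - 𝔾.horizontal (γ t) - τ (i + 1) • v) -
          (𝔾.horizontal (γ (t + τ i)) - 𝔾.horizontal (γ t) - τ i • v)) := by
      have h2 : (k : ℝ)⁻¹ • σ • v = s⁻¹ • (τ (i + 1) • v - τ i • v) := by
        rw [← sub_smul, hτd, smul_smul, smul_smul]
        congr 1
        field_simp
      rw [h2, ← smul_sub, ← smul_sub]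
      congr 1
      abel
    rw [h1, norm_smul, Real.norm_of_nonneg (by positivity), inv_mul_le_iff₀ hs0]
    calc _ ≤ δ / 2 * s + δ / 2 * s :=
          (norm_sub_le _ _).trans (add_le_add (hclose _ hi) (hclose _ hi.le))
      _ = s * δ := by ring

/-- The metric derivative of a Lipschitz curve is the norm of the derivative of its horizontal
part, at each point where the latter exists. -/
theorem metric_derivative (hd : 𝔾.IsHomogeneousMetric) (hd1 : 𝔾.IsNormalizedMetric)
    {γ : ℝ → G} {K : ℝ≥0} (hγ : LipschitzWith K γ) {t : ℝ}
    {v : EuclideanSpace ℝ {j : Fin N // 𝔾.deg j = 1}}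
    (hv : HasDerivAt (fun u => 𝔾.horizontal (γ u)) v t) {ε : ℝ} (hε : 0 < ε) :
    ∃ r > 0, ∀ s, dist s t < r → |dist (γ s) (γ t) - ‖v‖ * dist s t| ≤ ε * dist s t := by
  obtain ⟨r₁, hr₁, h₁⟩ := (mem_nhdsGT_iff_exists_Ioo_subset).1
    (dist_le_of_hasDerivAt hd hd1 hγ hv (σ := 1) (by simp) hε)
  obtain ⟨r₂, hr₂, h₂⟩ := (mem_nhdsGT_iff_exists_Ioo_subset).1
    (dist_le_of_hasDerivAt hd hd1 hγ hv (σ := -1) (by simp) hε)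
  obtain ⟨r₃, hr₃, h₃⟩ := Metric.eventually_nhds_iff.1
    ((hasDerivAt_iff_isLittleO_nhds_zero.1 hv).def hε)
  refine ⟨min r₁ (min r₂ r₃), lt_min hr₁ (lt_min hr₂ hr₃), fun s hs => ?_⟩
  obtain ⟨hs1, hs2, hs3⟩ : |s - t| < r₁ ∧ |s - t| < r₂ ∧ |s - t| < r₃ := by
    simpa [lt_min_iff, Real.dist_eq] using hs
  rw [Real.dist_eq s t, abs_le]
  constructor
  · have h4 := h₃ (y := s - t) (by simpa using hs3)
    rw [add_sub_cancel, Real.norm_eq_abs] at h4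
    have h5 := norm_horizontal_sub_le hd hd1 (γ s) (γ t)
    have h6 : ‖(s - t) • v‖ ≤ ‖𝔾.horizontal (γ s) - 𝔾.horizontal (γ t)‖ +
        ‖𝔾.horizontal (γ s) - 𝔾.horizontal (γ t) - (s - t) • v‖ := by
      simpa using norm_sub_le (𝔾.horizontal (γ s) - 𝔾.horizontal (γ t))
        (𝔾.horizontal (γ s) - 𝔾.horizontal (γ t) - (s - t) • v)
    rw [norm_smul, Real.norm_eq_abs] at h6
    linarith
  · rcases lt_trichotomy (s - t) 0 with h | h | h
    · rw [abs_of_neg h] at hs2 ⊢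
      have := @h₂ (-(s - t)) ⟨by linarith, hs2⟩
      simp only [mem_ofPred_eq, show t + -1 * -(s - t) = s by ring] at this
      linarith
    · obtain rfl : s = t := by linarith
      simp
    · rw [abs_of_pos h] at hs1 ⊢
      have := @h₁ (s - t) ⟨h, hs1⟩
      simp only [mem_ofPred_eq, show t + 1 * (s - t) = s by ring] at this
      linarith

end CarnotGroup

/-! ### The area formula for curves with a metric derivative -/

section AreaFormula

variable {X : Type*} [MetricSpace X]

/-- The curve `γ` has metric derivative `ℓ` at `t`, as the base point `t` is kept fixed. -/
def HasMetricDerivAt (γ : ℝ → X) (ℓ : ℝ≥0) (t : ℝ) : Prop :=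
  ∀ ε > 0, ∃ r > 0, ∀ s, dist s t < r → |dist (γ s) (γ t) - ℓ * dist s t| ≤ ε * dist s t

variable [MeasurableSpace X] [BorelSpace X]

theorem volume_le_hausdorffMeasure_image {γ : ℝ → X} {A : Set ℝ} {k : ℝ≥0}
    (h : ∀ s ∈ A, ∀ t ∈ A, k * dist s t ≤ dist (γ s) (γ t)) :
    k * volume A ≤ (μH[1] : Measure X) (γ '' A) := by
  rcases eq_or_ne k 0 with rfl | hk
  · simp
  have hk0 : (0 : ℝ) < k := by exact_mod_cast pos_iff_ne_zero.2 hk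
  have hinj : InjOn γ A := fun s hs t ht hst => by
    have := h s hs t ht
    rw [hst, dist_self] at this
    exact dist_le_zero.1 (by nlinarith [dist_nonneg (x := s) (y := t)])
  have hlip : LipschitzOnWith k⁻¹ (Function.invFunOn γ A) (γ '' A) := by
    refine LipschitzOnWith.of_dist_le_mul ?_
    rintro _ ⟨s, hs, rfl⟩ _ ⟨t, ht, rfl⟩
    rw [hinj.leftInvOn_invFunOn hs, hinj.leftInvOn_invFunOn ht, NNReal.coe_inv,
      le_inv_mul_iff₀ hk0]
    exact h s hs t ht
  have h1 := hlip.hausdorffMeasure_image_le (d := 1) zero_le_one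
  rw [hinj.leftInvOn_invFunOn.image_image, hausdorffMeasure_real, ENNReal.rpow_one] at h1
  calc (k : ℝ≥0∞) * volume A ≤ k * ((k⁻¹ : ℝ≥0) * (μH[1] : Measure X) (γ '' A)) := by gcongr
    _ = _ := by
      rw [← mul_assoc, ← ENNReal.coe_mul, mul_inv_cancel₀ hk, ENNReal.coe_one, one_mul]

theorem hausdorffMeasure_image_le_of_dist_le {γ : ℝ → X} {A : Set ℝ} {k : ℝ≥0}
    (h : ∀ s ∈ A, ∀ t ∈ A, dist (γ s) (γ t) ≤ k * dist s t) :
    (μH[1] : Measure X) (γ '' A) ≤ k * volume A := by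
  simpa [hausdorffMeasure_real] using
    (LipschitzOnWith.of_dist_le_mul h).hausdorffMeasure_image_le (d := 1) zero_le_one

/-- The points near which the curve is almost an isometry up to the factor `ℓ` can be decomposed
into countably many pieces on which the area formula holds up to a small error. -/
theorem exists_area_partition {γ : ℝ → X} (hγ : Continuous γ) {ℓ : ℝ → ℝ≥0} (hℓ : Measurable ℓ)
    {ε : ℝ≥0} (hε : 0 < ε) :
    ∃ P : ℕ → Set ℝ, (∀ i, MeasurableSet (P i)) ∧ Pairwise (Function.onFun Disjoint P) ∧
      {t | HasMetricDerivAt γ (ℓ t) t} ⊆ ⋃ i, P i ∧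
      ∀ i, ∀ A ⊆ P i, MeasurableSet A →
        (μH[1] : Measure X) (γ '' A) ≤ (∫⁻ t in A, ℓ t) + 3 * ε * volume A ∧
        ∫⁻ t in A, ℓ t ≤ (μH[1] : Measure X) (γ '' A) + 3 * ε * volume A := by
  -- The index `n` makes the radius uniform, `q` rounds `ℓ` to a multiple of `ε`, and the last index
  -- is a cell of length `1 / (n + 1)`, so that two points of a piece lie within the radius. The `2
  -- * ε` is the derivative error plus the rounding error; comparing `ε * q` with `ℓ` later adds a
  -- third `ε`.
  set T : ℕ × ℕ × ℤ → Set ℝ := fun p =>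
    {t | ∀ s, dist s t < 1 / ((p.1 : ℝ) + 1) →
      |dist (γ s) (γ t) - ε * p.2.1 * dist s t| ≤ 2 * ε * dist s t} ∩
    ({t | ℓ t ≤ ε * p.2.1 + ε} ∩ {t | ε * p.2.1 ≤ ℓ t + ε}) ∩
    {t | ⌊t * ((p.1 : ℝ) + 1)⌋ = p.2.2} with hT
  have hTm : ∀ p, MeasurableSet (T p) := by
    intro p
    refine (MeasurableSet.inter ?_ (MeasurableSet.inter ?_ ?_)).inter ?_
    · refine IsClosed.measurableSet ?_
      simp only [ofPred_forall]
      refine isClosed_iInter fun s => ?_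
      have : {t | dist s t < 1 / ((p.1 : ℝ) + 1) →
          |dist (γ s) (γ t) - ε * p.2.1 * dist s t| ≤ 2 * ε * dist s t} =
          {t | 1 / ((p.1 : ℝ) + 1) ≤ dist s t} ∪
          {t | |dist (γ s) (γ t) - ε * p.2.1 * dist s t| ≤ 2 * ε * dist s t} := by
        ext t
        simp only [mem_ofPred_eq, mem_union, ← not_lt (b := 1 / ((p.1 : ℝ) + 1))]
        tauto
      rw [show {x | dist s x < 1 / ((p.1 : ℝ) + 1) → _} = _ from this]
      exact (isClosed_le continuous_const (by fun_prop)).union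
        (isClosed_le (by fun_prop) (by fun_prop))
    · exact measurableSet_le hℓ measurable_const
    · exact measurableSet_le measurable_const (hℓ.add_const ε)
    · exact (Int.measurable_floor.comp (measurable_id.mul_const _)) (measurableSet_singleton _)
  have hTcover : ∀ t, HasMetricDerivAt γ (ℓ t) t → ∃ p, t ∈ T p := by
    intro t ht
    obtain ⟨r, hr, h⟩ := ht ε (by exact_mod_cast hε)
    obtain ⟨n, hn⟩ := exists_nat_one_div_lt hr
    set q := ⌊ℓ t / ε⌋₊ with hq
    have hq1 : ε * q ≤ ℓ t := by
      have := Nat.floor_le (zero_le : 0 ≤ ℓ t / ε)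
      rwa [le_div_iff₀ hε, mul_comm] at this
    have hq2 : ℓ t ≤ ε * q + ε := by
      have := (Nat.lt_floor_add_one (ℓ t / ε)).le
      rw [div_le_iff₀ hε] at this
      calc ℓ t ≤ _ := this
        _ = _ := by ring
    refine ⟨(n, q, ⌊t * ((n : ℝ) + 1)⌋), ⟨?_, hq2, hq1.trans le_self_add⟩, rfl⟩
    intro s hs
    have h1 := h s (hs.trans hn)
    have hq1' : (ε : ℝ) * q ≤ ℓ t := by exact_mod_cast hq1
    have hq2' : (ℓ t : ℝ) ≤ ε * q + ε := by exact_mod_cast hq2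
    have hd := dist_nonneg (x := s) (y := t)
    rw [abs_le] at h1 ⊢
    constructor <;> nlinarith
  have hTprop : ∀ p, ∀ A ⊆ T p, MeasurableSet A →
      (μH[1] : Measure X) (γ '' A) ≤ (∫⁻ t in A, ℓ t) + 3 * ε * volume A ∧
      ∫⁻ t in A, ℓ t ≤ (μH[1] : Measure X) (γ '' A) + 3 * ε * volume A := by
    rintro ⟨n, q, l⟩ A hA hAm
    set c : ℝ≥0 := ε * q with hc
    have hdist : ∀ s ∈ A, ∀ t ∈ A, |dist (γ s) (γ t) - c * dist s t| ≤ 2 * ε * dist s t := by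
      intro s hs t ht
      refine (hA ht).1.1 s ?_
      have h1 : ⌊s * ((n : ℝ) + 1)⌋ = l := (hA hs).2
      have h2 : ⌊t * ((n : ℝ) + 1)⌋ = l := (hA ht).2
      have h3 := Int.abs_sub_lt_one_of_floor_eq_floor (h1.trans h2.symm)
      rw [← sub_mul, abs_mul, abs_of_pos (by positivity : (0 : ℝ) < n + 1)] at h3
      rw [Real.dist_eq, lt_div_iff₀ (by positivity)]
      exact h3
    have hconst : ∀ k : ℝ≥0, (k : ℝ≥0∞) * volume A = ∫⁻ _ in A, (k : ℝ≥0∞) := fun k => by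
      rw [setLIntegral_const]
    have hadd : (∫⁻ t in A, ℓ t) + 3 * ε * volume A = ∫⁻ t in A, ((ℓ t + 3 * ε : ℝ≥0) : ℝ≥0∞) := by
      have := hconst (3 * ε)
      push_cast at this ⊢
      rw [this, lintegral_add_right _ measurable_const]
    constructor
    · calc (μH[1] : Measure X) (γ '' A) ≤ (c + 2 * ε : ℝ≥0) * volume A :=
            hausdorffMeasure_image_le_of_dist_le fun s hs t ht => by
              have := (abs_le.1 (hdist s hs t ht)).2
              push_cast
              linarith
        _ ≤ _ := by
          rw [hadd, hconst]
          refine setLIntegral_mono' hAm fun t ht => ?_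
          rw [ENNReal.coe_le_coe]
          have h1 : c ≤ ℓ t + ε := (hA ht).1.2.2
          calc c + 2 * ε ≤ ℓ t + ε + 2 * ε := by gcongr
            _ = _ := by ring
    -- The subtraction `c - 2 * ε` is truncated; where it vanishes the lower distance bound is
    -- trivial.
    · calc ∫⁻ t in A, ℓ t ≤ ∫⁻ _ in A, ((c - 2 * ε + 3 * ε : ℝ≥0) : ℝ≥0∞) := by
            refine setLIntegral_mono' hAm fun t ht => ?_
            rw [ENNReal.coe_le_coe]
            have h1 : ℓ t ≤ c + ε := (hA ht).1.2.1
            calc ℓ t ≤ c + ε := h1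
              _ ≤ c - 2 * ε + 2 * ε + ε := by gcongr; exact le_tsub_add
              _ = _ := by ring
        _ = (c - 2 * ε : ℝ≥0) * volume A + 3 * ε * volume A := by
          rw [← hconst]
          push_cast
          rw [add_mul]
        _ ≤ _ := by
          gcongr
          refine volume_le_hausdorffMeasure_image fun s hs t ht => ?_
          have h1 := (abs_le.1 (hdist s hs t ht)).1
          rcases le_total c (2 * ε) with h | h
          · rw [tsub_eq_zero_of_le h]
            simp
          · rw [NNReal.coe_sub h]
            push_cast
            linarith
  obtain ⟨e, he⟩ := exists_surjective_nat (ℕ × ℕ × ℤ)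
  refine ⟨disjointed (T ∘ e), fun i => MeasurableSet.disjointed (fun i => hTm _) i,
    disjoint_disjointed _, fun t ht => ?_, fun i A hA => hTprop (e i) A
      (hA.trans (disjointed_subset _ i))⟩
  rw [iUnion_disjointed]
  obtain ⟨p, hp⟩ := hTcover t ht
  obtain ⟨i, rfl⟩ := he p
  exact mem_iUnion.2 ⟨i, hp⟩

theorem ENNReal.le_of_forall_le_add_mul {x y z : ℝ≥0∞} (hz : z ≠ ⊤)
    (h : ∀ ε : ℝ≥0, 0 < ε → x ≤ y + 3 * ε * z) : x ≤ y := by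
  refine ENNReal.le_of_forall_pos_le_add fun δ hδ _ => ?_
  lift z to ℝ≥0 using hz
  refine (h (δ / (3 * (z + 1))) (by positivity)).trans ?_
  gcongr
  norm_cast
  calc 3 * (δ / (3 * (z + 1))) * z = δ * (z / (z + 1)) := by field_simp
    _ ≤ δ * 1 := by gcongr; exact (div_le_one (by positivity)).2 (by simp)
    _ = δ := mul_one δ

/-- Without injectivity the lower bound only sees the sum of the measures of the image pieces. That
sum is the measure of the whole image when `γ` is injective on `A`, and zero when the image is null.
-/
theorem exists_area_pieces {γ : ℝ → X} (hγ : Continuous γ)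
    {ℓ : ℝ → ℝ≥0} (hℓ : Measurable ℓ) {A : Set ℝ} (hA : MeasurableSet A) (hd : ∀ t ∈ A, HasMetricDerivAt γ (ℓ t) t)
    {ε : ℝ≥0} (hε : 0 < ε) :
    ∃ Q : ℕ → Set ℝ, (∀ i, MeasurableSet (Q i)) ∧ Pairwise (Function.onFun Disjoint Q) ∧
      A = ⋃ i, Q i ∧
      (μH[1] : Measure X) (γ '' A) ≤ (∫⁻ t in A, ℓ t) + 3 * ε * volume A ∧
      ∫⁻ t in A, ℓ t ≤ (∑' i, (μH[1] : Measure X) (γ '' Q i)) + 3 * ε * volume A := by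
  obtain ⟨P, hPm, hPd, hPc, hP⟩ := exists_area_partition hγ hℓ hε
  have hQm : ∀ i, MeasurableSet (A ∩ P i) := fun i => hA.inter (hPm i)
  have hQd : Pairwise (Function.onFun Disjoint fun i => A ∩ P i) := fun i j hij =>
    (hPd hij).mono inter_subset_right inter_subset_right
  have hQ : A = ⋃ i, A ∩ P i := by
    rw [← inter_iUnion, inter_eq_left.2 fun t ht => hPc (hd t ht)]
  have hint : ∫⁻ t in A, ℓ t = ∑' i, ∫⁻ t in A ∩ P i, ℓ t := by
    conv_lhs => rw [hQ]
    exact lintegral_iUnion hQm hQd _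
  have hvol : 3 * ε * volume A = ∑' i, 3 * ε * volume (A ∩ P i) := by
    conv_lhs => rw [hQ]
    rw [measure_iUnion hQd hQm, ENNReal.tsum_mul_left]
  refine ⟨fun i => A ∩ P i, hQm, hQd, hQ, ?_, ?_⟩
  · calc (μH[1] : Measure X) (γ '' A) = (μH[1] : Measure X) (⋃ i, γ '' (A ∩ P i)) := by
          conv_lhs => rw [hQ, image_iUnion]
      _ ≤ ∑' i, (μH[1] : Measure X) (γ '' (A ∩ P i)) := measure_iUnion_le _
      _ ≤ _ := by
        rw [hint, hvol, ← ENNReal.tsum_add]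
        exact ENNReal.tsum_le_tsum fun i => (hP i _ inter_subset_right (hQm i)).1
  · rw [hint, hvol, ← ENNReal.tsum_add]
    exact ENNReal.tsum_le_tsum fun i => (hP i _ inter_subset_right (hQm i)).2

theorem hausdorffMeasure_image_le_lintegral {γ : ℝ → X} (hγ : Continuous γ)
    {ℓ : ℝ → ℝ≥0} (hℓ : Measurable ℓ) {A : Set ℝ} (hA : MeasurableSet A) (hAfin : volume A ≠ ⊤)
    (hd : ∀ t ∈ A, HasMetricDerivAt γ (ℓ t) t) :
    (μH[1] : Measure X) (γ '' A) ≤ ∫⁻ t in A, ℓ t :=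
  ENNReal.le_of_forall_le_add_mul hAfin fun _ hε =>
    let ⟨_, _, _, _, h, _⟩ := exists_area_pieces hγ hℓ hA hd hε
    h

theorem lintegral_le_hausdorffMeasure_image {γ : ℝ → X} (hγ : Continuous γ)
    {ℓ : ℝ → ℝ≥0} (hℓ : Measurable ℓ) {A : Set ℝ} (hA : MeasurableSet A) (hAfin : volume A ≠ ⊤)
    (hd : ∀ t ∈ A, HasMetricDerivAt γ (ℓ t) t) (hinj : InjOn γ A) :
    ∫⁻ t in A, ℓ t ≤ (μH[1] : Measure X) (γ '' A) := by
  refine ENNReal.le_of_forall_le_add_mul hAfin fun ε hε => ?_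
  obtain ⟨Q, hQm, hQd, hQ, -, h⟩ := exists_area_pieces hγ hℓ hA hd hε
  have hsub : ∀ i, Q i ⊆ A := fun i => by rw [hQ]; exact subset_iUnion Q i
  rw [← measure_iUnion, ← image_iUnion, ← hQ] at h
  · exact h
  · intro i j hij
    refine disjoint_left.2 ?_
    rintro _ ⟨s, hs, rfl⟩ ⟨t, ht, hst⟩
    rw [hinj (hsub j ht) (hsub i hs) hst] at ht
    exact disjoint_left.1 (hQd hij) hs ht
  · exact fun i => (hQm i).image_of_continuousOn_injOn hγ.continuousOn (hinj.mono (hsub i))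

/-- This disposes of the parameters over points with several preimages: they may have positive
length, but the metric derivative vanishes almost everywhere on them. -/
theorem lintegral_eq_zero_of_hausdorffMeasure_image {γ : ℝ → X} (hγ : Continuous γ)
    {ℓ : ℝ → ℝ≥0} (hℓ : Measurable ℓ) {A : Set ℝ} (hA : MeasurableSet A) (hAfin : volume A ≠ ⊤)
    (hd : ∀ t ∈ A, HasMetricDerivAt γ (ℓ t) t)
    (h0 : (μH[1] : Measure X) (γ '' A) = 0) : ∫⁻ t in A, ℓ t = 0 := by
  refine le_antisymm (ENNReal.le_of_forall_le_add_mul hAfin fun ε hε => ?_) zero_le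
  obtain ⟨Q, hQm, hQd, hQ, -, h⟩ := exists_area_pieces hγ hℓ hA hd hε
  have hsub : ∀ i, Q i ⊆ A := fun i => by rw [hQ]; exact subset_iUnion Q i
  simpa [fun i => measure_mono_null (image_mono (hsub i)) h0] using h

/-- The area formula for an essentially injective Lipschitz curve with a metric derivative
almost everywhere: the Hausdorff measure on the image is the push-forward of the metric
derivative. -/
theorem hausdorffMeasure_restrict_image_eq_map {γ : ℝ → X} {K : ℝ≥0} (hγ : LipschitzWith K γ)
    {ℓ : ℝ → ℝ≥0} (hℓ : Measurable ℓ) {a b : ℝ}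
    (hd : ∀ᵐ t ∂(volume.restrict (Icc a b)), HasMetricDerivAt γ (ℓ t) t)
    (hinj : ∀ᵐ p ∂((μH[1] : Measure X).restrict (γ '' Icc a b)), ∃! t, t ∈ Icc a b ∧ γ t = p) :
    (μH[1] : Measure X).restrict (γ '' Icc a b) =
      ((volume.restrict (Icc a b)).withDensity fun t => ℓ t).map γ := by
  have hγc := hγ.continuous
  have hI : MeasurableSet (Icc a b) := measurableSet_Icc
  have hGm : MeasurableSet (γ '' Icc a b) := (isCompact_Icc.image hγc).measurableSet
  rw [ae_restrict_iff' hI] at hd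
  obtain ⟨Z, hZ, hZm, hZ0⟩ := exists_measurable_superset_of_null (ae_iff.1 hd)
  rw [ae_restrict_iff' hGm] at hinj
  obtain ⟨S, hS, hSm, hS0⟩ := exists_measurable_superset_of_null (ae_iff.1 hinj)
  ext B hB
  rw [Measure.restrict_apply hB, Measure.map_apply hγc.measurable hB,
    withDensity_apply _ (hγc.measurable hB), Measure.restrict_restrict (hγc.measurable hB),
    ← image_preimage_inter]
  set A := γ ⁻¹' B ∩ Icc a b with hA
  have hAm : MeasurableSet A := (hγc.measurable hB).inter hI
  have hAI : A ⊆ Icc a b := inter_subset_right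
  -- Here `Z` carries the parameters without metric derivative and `S` the points with several
  -- preimages. On `A₁` the curve is injective, the image of `A₂` is null, and `A ∩ Z` is null with
  -- null image.
  set A₁ := (A \ Z) \ γ ⁻¹' S with hA₁
  set A₂ := (A \ Z) ∩ γ ⁻¹' S with hA₂
  have hm₁ : MeasurableSet A₁ := (hAm.diff hZm).diff (hγc.measurable hSm)
  have hm₂ : MeasurableSet A₂ := (hAm.diff hZm).inter (hγc.measurable hSm)
  have hsub : ∀ C ⊆ A \ Z, volume C ≠ ⊤ ∧ ∀ t ∈ C, HasMetricDerivAt γ (ℓ t) t := fun C hC =>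
    ⟨((measure_mono ((hC.trans sdiff_subset).trans hAI)).trans_lt (by simp)).ne, fun t ht => by
      by_contra h
      exact (hC ht).2 (hZ fun h' => h (h' (hAI (hC ht).1)))⟩
  obtain ⟨hf₁, hd₁⟩ := hsub A₁ sdiff_subset
  obtain ⟨hf₂, hd₂⟩ := hsub A₂ inter_subset_left
  have hinj₁ : InjOn γ A₁ := fun s hs t ht hst => by
    by_contra hne
    refine hs.2 (hS fun h => hne ?_)
    exact (h ⟨s, hAI hs.1.1, rfl⟩).unique ⟨hAI hs.1.1, rfl⟩ ⟨hAI ht.1.1, hst.symm⟩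
  have hγZ : (μH[1] : Measure X) (γ '' Z) = 0 := by
    have := hγ.lipschitzOnWith.hausdorffMeasure_image_le (s := Z) (d := 1) zero_le_one
    rw [hausdorffMeasure_real, hZ0, mul_zero] at this
    exact le_antisymm this zero_le
  have hint₂ : ∫⁻ t in A₂, ℓ t = 0 :=
    lintegral_eq_zero_of_hausdorffMeasure_image hγc hℓ hm₂ hf₂ hd₂
      (measure_mono_null (by rintro _ ⟨t, ht, rfl⟩; exact ht.2) hS0)
  have hAeq : A = A₁ ∪ (A₂ ∪ A ∩ Z) := by
    rw [← union_assoc, hA₁, hA₂, sdiff_union_inter, sdiff_union_inter]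
  apply le_antisymm
  · calc (μH[1] : Measure X) (γ '' A) ≤ (μH[1] : Measure X) (γ '' A₁) +
            ((μH[1] : Measure X) S + (μH[1] : Measure X) (γ '' Z)) := by
          refine le_trans ?_ ((measure_union_le _ _).trans
            (add_le_add_right (measure_union_le _ _) _))
          refine measure_mono ?_
          conv_lhs => rw [hAeq]
          rw [image_union, image_union]
          refine union_subset_union_right _ (union_subset_union ?_ (image_mono inter_subset_right))
          rintro _ ⟨t, ht, rfl⟩
          exact ht.2
      _ = (μH[1] : Measure X) (γ '' A₁) := by
          rw [hS0, hγZ, add_zero, add_zero]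
      _ ≤ ∫⁻ t in A₁, ℓ t := hausdorffMeasure_image_le_lintegral hγc hℓ hm₁ hf₁ hd₁
      _ ≤ ∫⁻ t in A, ℓ t := lintegral_mono_set (sdiff_subset.trans sdiff_subset)
  · calc ∫⁻ t in A, ℓ t ≤ (∫⁻ t in A₁, ℓ t) + ((∫⁻ t in A₂, ℓ t) + ∫⁻ t in A ∩ Z, ℓ t) := by
          conv_lhs => rw [hAeq]
          exact (lintegral_union_le _ _ _).trans (by gcongr; exact lintegral_union_le _ _ _)
      _ = ∫⁻ t in A₁, ℓ t := by
          rw [hint₂, setLIntegral_measure_zero _ _ (measure_mono_null inter_subset_right hZ0),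
            add_zero, add_zero]
      _ ≤ (μH[1] : Measure X) (γ '' A₁) :=
          lintegral_le_hausdorffMeasure_image hγc hℓ hm₁ hf₁ hd₁ hinj₁
      _ ≤ _ := measure_mono (image_mono (sdiff_subset.trans sdiff_subset))

end AreaFormula

/-! ### Conclusion for curves in a Carnot group -/

namespace CarnotGroup

variable {G : Type*} [Group G] {N : ℕ} {𝔾 : CarnotGroup G N} [MetricSpace G]

theorem ae_differentiableAt_horizontal (hd : 𝔾.IsHomogeneousMetric)
    (hd1 : 𝔾.IsNormalizedMetric) {γ : ℝ → G} {K : ℝ≥0} (hγ : LipschitzWith K γ) :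
    ∀ᵐ t, DifferentiableAt ℝ (fun u => 𝔾.horizontal (γ u)) t := by
  refine LipschitzWith.ae_differentiableAt (C := K) (LipschitzWith.of_dist_le_mul fun s t => ?_)
  rw [dist_eq_norm]
  exact (norm_horizontal_sub_le hd hd1 _ _).trans (hγ.dist_le_mul s t)

theorem ae_hasMetricDerivAt (hd : 𝔾.IsHomogeneousMetric)
    (hd1 : 𝔾.IsNormalizedMetric) {γ : ℝ → G} {K : ℝ≥0} (hγ : LipschitzWith K γ) :
    ∀ᵐ t, HasMetricDerivAt γ ‖deriv (fun u => 𝔾.horizontal (γ u)) t‖₊ t := by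
  filter_upwards [ae_differentiableAt_horizontal hd hd1 hγ] with t ht ε hε
  exact metric_derivative hd hd1 hγ ht.hasDerivAt hε

end CarnotGroup

theorem proposition3p1 {G : Type*} [Group G] {N : ℕ} (𝔾 : CarnotGroup G N)
    [MetricSpace G] [MeasurableSpace G] [BorelSpace G]
    (hd : 𝔾.IsHomogeneousMetric) (hd1 : 𝔾.IsNormalizedMetric)
    {a b : ℝ} (hab : a ≤ b) (γ : ℝ → G) (K : ℝ≥0) (hγ : LipschitzOnWith K γ (Icc a b))
    (hinj : ∀ᵐ p ∂((μH[1] : Measure G).restrict (γ '' Icc a b)), ∃! t, t ∈ Icc a b ∧ γ t = p)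
    (η : G → ℝ) (hη : Integrable η ((μH[1] : Measure G).restrict (γ '' Icc a b))) :
    (∀ᵐ t ∂(volume.restrict (Icc a b)),
        DifferentiableAt ℝ (fun u => 𝔾.horizontal (γ u)) t) ∧
      IntervalIntegrable
        (fun t => η (γ t) * ‖deriv (fun u => 𝔾.horizontal (γ u)) t‖) volume a b ∧
      ∫ p in γ '' Icc a b, η p ∂(μH[1] : Measure G) =
        ∫ t in a..b, η (γ t) * ‖deriv (fun u => 𝔾.horizontal (γ u)) t‖ := by
  -- extend the curve by constants beyond the endpoints
  set β : ℝ → G := fun t => γ (projIcc a b hab t) with hβ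
  have hβγ : ∀ t ∈ Icc a b, β t = γ t := fun t ht => by simp [hβ, projIcc_of_mem hab ht]
  have hβL : LipschitzWith K β := by
    refine LipschitzWith.of_dist_le_mul fun s t => ?_
    refine (hγ.dist_le_mul _ (projIcc a b hab s).2 _ (projIcc a b hab t).2).trans ?_
    gcongr
    have h := (LipschitzWith.projIcc hab).dist_le_mul s t
    rwa [NNReal.coe_one, one_mul] at h
  have himage : β '' Icc a b = γ '' Icc a b := image_congr hβγ
  -- Only interior points are used: at `a` and `b` the derivatives of the two curves may differ,
  -- since `γ` is arbitrary outside the interval.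
  have hevent : ∀ t ∈ Ioo a b,
      (fun u => 𝔾.horizontal (β u)) =ᶠ[𝓝 t] fun u => 𝔾.horizontal (γ u) := fun t ht => by
    filter_upwards [Ioo_mem_nhds ht.1 ht.2] with u hu
    rw [hβγ u (Ioo_subset_Icc_self hu)]
  have hIoo : ∀ᵐ t ∂(volume.restrict (Icc a b)), t ∈ Ioo a b := by
    rw [← restrict_Ioo_eq_restrict_Icc]
    exact ae_restrict_mem measurableSet_Ioo
  set ℓ : ℝ → ℝ≥0 := fun t => ‖deriv (fun u => 𝔾.horizontal (β u)) t‖₊ with hℓ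
  have hℓm : Measurable ℓ := (measurable_deriv _).nnnorm
  have hβinj : ∀ᵐ p ∂((μH[1] : Measure G).restrict (β '' Icc a b)),
      ∃! t, t ∈ Icc a b ∧ β t = p := by
    rw [himage]
    filter_upwards [hinj] with p hp
    refine (existsUnique_congr fun t => ?_).2 hp
    exact and_congr_right fun ht => by rw [hβγ t ht]
  have hmap := hausdorffMeasure_restrict_image_eq_map hβL hℓm
    (ae_restrict_of_ae (CarnotGroup.ae_hasMetricDerivAt hd hd1 hβL)) hβinj
  rw [himage] at hmap
  have hβm : Measurable β := hβL.continuous.measurable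
  have hcongr : (fun t => ℓ t • η (β t)) =ᵐ[volume.restrict (Icc a b)]
      fun t => η (γ t) * ‖deriv (fun u => 𝔾.horizontal (γ u)) t‖ := by
    filter_upwards [hIoo] with t ht
    rw [hβγ t (Ioo_subset_Icc_self ht), NNReal.smul_def, smul_eq_mul, mul_comm, hℓ]
    simp only [coe_nnnorm]
    rw [(hevent t ht).deriv_eq]
  rw [hmap] at hη
  have hint : Integrable (fun t => ℓ t • η (β t)) (volume.restrict (Icc a b)) := by
    rw [← integrable_withDensity_iff_integrable_smul hℓm]
    exact hη.comp_measurable hβm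
  refine ⟨?_, ?_, ?_⟩
  · filter_upwards [hIoo, ae_restrict_of_ae
      (CarnotGroup.ae_differentiableAt_horizontal hd hd1 hβL)] with t ht h
    exact (hevent t ht).differentiableAt_iff.1 h
  · rw [intervalIntegrable_iff_integrableOn_Icc_of_le hab]
    exact hint.congr hcongr
  · rw [hmap, integral_map hβm.aemeasurable hη.aestronglyMeasurable,
      integral_withDensity_eq_integral_smul hℓm, intervalIntegral.integral_of_le hab,
      ← integral_Icc_eq_integral_Ioc]
    exact integral_congr_ae hcongr
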